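/- A network is a finite connected simple graph $G=(V,E)$ with $n=|V|$ nodes, which carry distinct identifiers from $\{0,\dots,n^{c}-1\}$, for a fixed integer $c\ge 1$; the edges at a node are numbered by ports. In the CONGEST model all nodes run the same algorithm in synchronous rounds, and in each round every node may send to each of its neighbours a message of $O(\log n)$ bits. Initially a node knows the parameters of the problem, its own identifier and its degree (and, in a randomized algorithm, its own private independent fair random bits); local computation is free. For an integer $k\ge 1$ and $\alpha\ge 1$, an $\alpha$-approximation algorithm for $k$-MaxM must terminate at all nodes in one of two ways: either with a matching of $G$ with at least $k/\alpha$ edges, where every node outputs which of its edges belong to the matching (so both ends of an edge agree); or with the report of all nodes that $G$ has no matching of size $k$, which is allowed only if this is true. In particular, if $G$ has a matching of size $k$, then a matching with at least $k/\alpha$ edges must be found, and if $G$ has no matching with at least $k/\alpha$ edges, then all nodes must report. A randomized (Monte Carlo) algorithm errs with probability at most $\delta$ if, on every network, the outcome is of this kind with probability at least $1-\delta$. **Theorem.** For every $c$ there is a constant $B$ such that the following holds with messages of at most $B\lfloor\log_2 n\rfloor$ bits. 1. There is a constant $C$ such that for all integers $k\ge1$ and all $\varepsilon\in[1/k,1]$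 there is a deterministic $(2-\varepsilon)$-approximation algorithm for $k$-MaxM which terminates on every network within $C\,(k+(k\varepsilon)^2)$ rounds. 2. For every $a>0$ there is a constant $C$ such that for all integers $k\ge1$, all $\varepsilon\in[1/k,1]$ and all $\delta\ge(k\varepsilon)^{-a}$ there is a randomized $(2-\varepsilon)$-approximation algorithm for $k$-MaxM which errs with probability at most $\delta$ and, for all outcomes of its random bits, terminates on every network within $$C\left(k+\frac{(k\varepsilon)^2\log(k\varepsilon)}{\log n}\right)$$ rounds (for $n=1$ the fraction is read as $0$). -/

import Mathlib

namespace Congest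

/-- A communication network on the vertex set `V`: a simple graph whose nodes carry distinct
identifiers.  The edges at a node `v` are numbered by the ports `0, …, deg v - 1`. -/
structure Network (V : Type) where
  graph : SimpleGraph V
  id : V → ℕ
  id_injective : Function.Injective id
  deg : V → ℕ
  port : ∀ v : V, Fin (deg v) ≃ graph.neighborSet v

namespace Network

variable {V : Type} (N : Network V)

/-- The neighbour of `v` behind port `p`. -/
def nbr (v : V) (p : Fin (N.deg v)) : V := (N.port v p : V)

theorem adj_nbr (v : V) (p : Fin (N.deg v)) : N.graph.Adj v (N.nbr v p) := (N.port v p).2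

/-- The port which the neighbour of `v` behind port `p` uses for its edge to `v`. -/
def backPort (v : V) (p : Fin (N.deg v)) : Fin (N.deg (N.nbr v p)) :=
  (N.port (N.nbr v p)).symm ⟨v, (N.adj_nbr v p).symm⟩

end Network

/-- The final answer of a single node: either the report that there is no matching of size `k`,
or the set of those of its ports whose edges belong to the computed matching. -/
inductive Answer where
  | noSolution : Answer
  | matched (S : Set ℕ) : Answer

/-- A synchronous message passing algorithm, run by all nodes.  A node starts with a private input
from `I` (trivial for deterministic algorithms, random bits for randomized ones), with its degree
and with its identifier; it does not know the network, nor its size, nor its neighbours.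
Messages are bit strings (the empty string stands for silence).  Local computation is free.
`output s = none` means that a node in state `s` has not terminated yet. -/
structure Algorithm (I : Type) where
  State : Type
  init : I → (deg : ℕ) → (ident : ℕ) → State
  send : State → (port : ℕ) → List Bool
  receive : State → (inbox : ℕ → List Bool) → State
  output : State → Option Answer

namespace Algorithm

variable {I V : Type} (A : Algorithm I) (N : Network V)

/-- The message which `v` sends through its port `p` when the nodes are in the states `s`;
a node that has terminated sends nothing. -/
def message (s : V → A.State) (v : V) (p : Fin (N.deg v)) : List Bool :=
  if (A.output (s v)).isSome then [] else A.send (s v) p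

/-- What `v` receives, port by port, when the nodes are in the states `s`. -/
def inbox (s : V → A.State) (v : V) (p : ℕ) : List Bool :=
  if h : p < N.deg v then A.message N s (N.nbr v ⟨p, h⟩) (N.backPort v ⟨p, h⟩) else []

/-- One synchronous round; a node that has terminated keeps its state, hence its answer. -/
def round (s : V → A.State) (v : V) : A.State :=
  if (A.output (s v)).isSome then s v else A.receive (s v) (A.inbox N s v)

/-- The states of all nodes after `t` rounds, on the private inputs `x`. -/
def run (x : V → I) : ℕ → V → A.State
  | 0 => fun v => A.init (x v) (N.deg v) (N.id v)
  | t + 1 => A.round N (run x t)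

/-- In the execution on the private inputs `x`, no message is ever longer than `b` bits. -/
def RespectsBandwidth (x : V → I) (b : ℕ) : Prop :=
  ∀ (t : ℕ) (v : V) (p : Fin (N.deg v)), (A.message N (A.run N x t) v p).length ≤ b

/-- In the execution on the private inputs `x`, all nodes have terminated after `t` rounds. -/
def TerminatesBy (x : V → I) (t : ℕ) : Prop :=
  ∀ v : V, (A.output (A.run N x t v)).isSome

end Algorithm

/-- `G` has a matching with at least `k` edges. -/
def HasMatching {V : Type} (G : SimpleGraph V) (k : ℕ) : Prop :=
  ∃ M : G.Subgraph, M.IsMatching ∧ k ≤ M.edgeSet.ncard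

/-- The answers `out` are a correct `α`-approximate answer to the problem of finding a matching of
size `k`: either they describe a matching with at least `k / α` edges (every node selects exactly
the ports of its matching edges, so that the two ends of an edge agree), or every node reports
that there is no matching of size `k`, and there is none.  In particular, if a matching of size `k`
exists, then the first case must hold. -/
def IsApproxSolution {V : Type} (N : Network V) (k : ℕ) (α : ℝ) (out : V → Answer) : Prop :=
  (∃ M : N.graph.Subgraph, M.IsMatching ∧ (k : ℝ) / α ≤ (M.edgeSet.ncard : ℝ) ∧
      ∀ v : V, ∃ S : Set ℕ, out v = Answer.matched S ∧
        ∀ p : Fin (N.deg v), (p : ℕ) ∈ S ↔ M.Adj v (N.nbr v p)) ∨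
    ((∀ v : V, out v = Answer.noSolution) ∧ ¬ HasMatching N.graph k)

/-- On the private inputs `x`, all nodes have terminated after `t` rounds, and their answers are a
correct `α`-approximate answer. -/
def Algorithm.Succeeds {I V : Type} (A : Algorithm I) (N : Network V) (k : ℕ) (α : ℝ)
    (x : V → I) (t : ℕ) : Prop :=
  ∃ out : V → Answer, (∀ v : V, A.output (A.run N x t v) = some (out v)) ∧
    IsApproxSolution N k α out

/-- The probability of `E` under the uniform distribution on the finite type `Ω`. -/
noncomputable def uniformProb {Ω : Type} (E : Set Ω) : ℝ := (E.ncard : ℝ) / (Nat.card Ω : ℝ)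

/-- `A` is a deterministic `α`-approximation algorithm for the problem of finding a matching of
size `k`, in the CONGEST model with messages of at most `B * log₂ n` bits, on all connected networks
with identifiers below `n ^ c`, within `T n` rounds, where `n` is the number of nodes. -/
def IsDetApprox (c B k : ℕ) (α : ℝ) (T : ℕ → ℝ) (A : Algorithm Unit) : Prop :=
  ∀ (V : Type) [Fintype V] (N : Network V), N.graph.Connected →
    (∀ v : V, N.id v < Fintype.card V ^ c) →
    A.RespectsBandwidth N (fun _ => ()) (B * Nat.log 2 (Fintype.card V)) ∧
    ∃ t : ℕ, (t : ℝ) ≤ T (Fintype.card V) ∧ A.Succeeds N k α (fun _ => ()) t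

/-- `A` is a Monte Carlo `α`-approximation algorithm with error probability at most `δ` for the
problem of finding a matching of size `k`, in the same model, where every node has `l` private,
independent, fair random bits.  The bounds on messages and rounds hold for all outcomes of these. -/
def IsRandApprox (c B k : ℕ) (α δ : ℝ) (T : ℕ → ℝ) {l : ℕ} (A : Algorithm (Fin l → Bool)) : Prop :=
  ∀ (V : Type) [Fintype V] (N : Network V), N.graph.Connected →
    (∀ v : V, N.id v < Fintype.card V ^ c) →
    (∀ x : V → Fin l → Bool, A.RespectsBandwidth N x (B * Nat.log 2 (Fintype.card V))) ∧
    ∃ t : ℕ, (t : ℝ) ≤ T (Fintype.card V) ∧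
      (∀ x : V → Fin l → Bool, A.TerminatesBy N x t) ∧
      uniformProb {x : V → Fin l → Bool | ¬ A.Succeeds N k α x t} ≤ δ

end Congest

namespace Congest

/-! ### Programs of a single node -/

/-! Put m = ⌊k(1-ε)/(2-ε)⌋ and K = k - m. Then K ≥ k/(2-ε) and K - m ≤ 3kε (`exists_split`), so it
suffices to find K matching edges or to be certain that no matching has K + m edges.

After K greedy iterations there are K matching edges or the matching is maximal. If it is maximal
with fewer than K edges, its nodes form a vertex cover of fewer than 2K nodes. All distances are
then at most 4K (`forall_walk_or_exists_cover`), and O(K) rounds of pipelined flooding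
(`items_subset_or_le_card`) tell everybody the whole matching (`Paired.gossip_dichotomy`).

Now m of these edges are settled for good. The 2m settled nodes meet at most 2m edges of a matching
with K + m edges, so K - m of its edges avoid them (`exists_arcs_avoiding`) and complete the settled
edges to K. That one settled edge costs up to two others is the source of the factor 2-ε. The edges
outside the settled nodes are covered by the set C of the other matched nodes, and |C| ≤ 2(K-m) =
O(kε). It is enough that each node of C announces 2|C| neighbours: an arc whose head is not
announced can be redirected to an announced node unused by the other arcs
(`ArcDisjoint.exists_kept`). So O((kε)²) announcements are flooded, and all nodes compute the same
solution locally.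

With randomness, neighbours are announced by random colors of l = O(log(kε)) bits instead of
identifiers, and a message holds about (log n)/l of them. Only the at most 6kε heads of one fixed
family of arcs need distinct colors; by a union bound this fails with probability at most (kε)^(-a).
A collision may hide a solution, but never yields a wrong matching (`Valid.outcome_of_solvable`).
Since nodes do not know n, they use the sum of deg + 1 over the matched nodes, which lies between n
and n² when n > 1 and the matching is maximal. -/

/-- The program of a node: either it stops with an answer, or it sends a number through each port,
and continues depending on the numbers received.  The number `0` stands for silence. -/
inductive Prog where
  | done (a : Answer) : Prog
  | step (send : ℕ → ℕ) (next : (ℕ → ℕ) → Prog) : Prog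

/-- The number with the given binary digits, least significant digit first. -/
def ofBits (l : List Bool) : ℕ := l.foldr Nat.bit 0

theorem ofBits_bits (n : ℕ) : ofBits n.bits = n := by
  induction n using Nat.binaryRec' with
  | zero => simp [ofBits]
  | bit b n h ih => rw [Nat.bits_append_bit n b h]; simpa [ofBits] using congrArg (Nat.bit b) ih

namespace Prog

/-- The algorithm in which every node executes a program, numbers being sent in binary. -/
def toAlgorithm {I : Type} (init : I → ℕ → ℕ → Prog) : Algorithm I where
  State := Prog
  init := init
  send s p := match s with
    | done _ => []
    | step f _ => (f p).bits
  receive s inb := match s with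
    | done a => done a
    | step _ g => g fun p => ofBits (inb p)
  output s := match s with
    | done a => some a
    | step _ _ => none

end Prog

variable {V : Type}

/-- What node `v` receives through port `p`, if every node `u` sends `f u q` through port `q`. -/
def Network.deliver (N : Network V) (f : V → ℕ → ℕ) (v : V) (p : ℕ) : ℕ :=
  if h : p < N.deg v then f (N.nbr v ⟨p, h⟩) (N.backPort v ⟨p, h⟩) else 0

/-- `Exec N Q t s out`: starting with the programs `s`, the nodes execute exactly `t` rounds, sending
only numbers below `Q`, and then stop with the answers `out`. -/
inductive Exec (N : Network V) (Q : ℕ) : ℕ → (V → Prog) → (V → Answer) → Prop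
  | done (out : V → Answer) : Exec N Q 0 (fun v => .done (out v)) out
  | step {t : ℕ} {out : V → Answer} (f : V → ℕ → ℕ) (g : V → (ℕ → ℕ) → Prog)
      (hf : ∀ v p, p < N.deg v → f v p < Q)
      (h : Exec N Q t (fun v => g v (N.deliver f v)) out) :
      Exec N Q (t + 1) (fun v => .step (f v) (g v)) out

/-- The bridge from the relational description to the message passing model. The starting round `r`
is arbitrary so that the induction can advance it by one. -/
theorem Exec.run {I : Type} {N : Network V} {Q b : ℕ} (hQ : Q ≤ 2 ^ b)
    (init : I → ℕ → ℕ → Prog) (x : V → I) {t : ℕ} {s : V → Prog} {out : V → Answer}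
    (h : Exec N Q t s out) : ∀ r : ℕ, (Prog.toAlgorithm init).run N x r = s →
      (∀ j, t ≤ j → (Prog.toAlgorithm init).run N x (r + j) = fun v => .done (out v)) ∧
      ∀ (j : ℕ) (v : V) (p : Fin (N.deg v)),
        ((Prog.toAlgorithm init).message N ((Prog.toAlgorithm init).run N x (r + j)) v p).length
          ≤ b := by
  induction h with
  | done out =>
    intro r hr
    have key : ∀ j, (Prog.toAlgorithm init).run N x (r + j) = fun v => .done (out v) := by
      intro j
      induction j with
      | zero => exact hr
      | succ j ih =>
        funext v
        rw [← add_assoc, Algorithm.run, ih]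
        rfl
    refine ⟨fun j _ => key j, fun j v p => ?_⟩
    rw [key j]
    exact Nat.zero_le b
  | @step t out f g hf h ih =>
    intro r hr
    have hmsg : ∀ v (p : Fin (N.deg v)),
        (Prog.toAlgorithm init).message N (fun v => Prog.step (f v) (g v)) v p
          = (f v p).bits := fun v p => rfl
    have hnext : (Prog.toAlgorithm init).run N x (r + 1) = fun v => g v (N.deliver f v) := by
      funext v
      rw [Algorithm.run, hr]
      change g v _ = g v _
      congr 1
      funext p
      unfold Network.deliver Algorithm.inbox
      split_ifs with hp
      · rw [hmsg, ofBits_bits]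
      · rfl
    obtain ⟨h1, h2⟩ := ih (r + 1) hnext
    constructor
    · intro j hj
      obtain ⟨i, rfl⟩ : ∃ i, j = i + 1 := ⟨j - 1, by omega⟩
      have := h1 i (by omega)
      rwa [add_assoc, add_comm 1 i] at this
    · intro j v p
      cases j with
      | zero =>
        rw [add_zero, hr, hmsg, Nat.size_eq_bits_len, Nat.size_le]
        exact (hf v p p.2).trans_le hQ
      | succ i =>
        have := h2 i v p
        rwa [add_assoc, add_comm 1 i] at this

/-! ### Links of a network -/

namespace Network

variable (N : Network V)

/-- There is an edge between `v` and `w`, with port `p` at `v` and port `q` at `w`. -/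
def Link (v : V) (p : ℕ) (w : V) (q : ℕ) : Prop :=
  ∃ (hp : p < N.deg v) (hq : q < N.deg w), N.nbr v ⟨p, hp⟩ = w ∧ N.nbr w ⟨q, hq⟩ = v

variable {N} {v w w' : V} {p p' q q' : ℕ}

theorem Link.symm (h : N.Link v p w q) : N.Link w q v p := by
  obtain ⟨hp, hq, h1, h2⟩ := h
  exact ⟨hq, hp, h2, h1⟩

theorem Link.adj (h : N.Link v p w q) : N.graph.Adj v w := by
  obtain ⟨hp, _, rfl, _⟩ := h
  exact N.adj_nbr _ _

theorem nbr_injective (v : V) : Function.Injective (N.nbr v) :=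
  fun _ _ h => (N.port v).injective (Subtype.ext h)

theorem nbr_backPort (v : V) (p : Fin (N.deg v)) : N.nbr (N.nbr v p) (N.backPort v p) = v :=
  congrArg Subtype.val ((N.port (N.nbr v p)).apply_symm_apply _)

theorem link_backPort (v : V) (p : Fin (N.deg v)) :
    N.Link v p (N.nbr v p) (N.backPort v p) :=
  ⟨p.2, (N.backPort v p).2, rfl, nbr_backPort v p⟩

theorem exists_link_of_lt (hp : p < N.deg v) : ∃ w q, N.Link v p w q :=
  ⟨_, _, link_backPort v ⟨p, hp⟩⟩

theorem exists_link_of_adj (h : N.graph.Adj v w) : ∃ p q, N.Link v p w q := by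
  obtain ⟨p, hp⟩ := (N.port v).surjective ⟨w, h⟩
  have hp : N.nbr v p = w := congrArg Subtype.val hp
  subst hp
  exact ⟨_, _, link_backPort v p⟩

theorem Link.port_eq (h : N.Link v p w q) (h' : N.Link v p' w q') : p = p' := by
  obtain ⟨_, _, h1, _⟩ := h
  obtain ⟨_, _, h2, _⟩ := h'
  exact Fin.mk.inj_iff.1 (nbr_injective v (h1.trans h2.symm))

theorem Link.node_eq (h : N.Link v p w q) (h' : N.Link v p w' q') : w = w' := by
  obtain ⟨_, _, h1, _⟩ := h
  obtain ⟨_, _, h2, _⟩ := h'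
  exact h1.symm.trans h2

theorem Link.back_eq (h : N.Link v p w q) (h' : N.Link v p w' q') : q = q' := by
  obtain rfl := h.node_eq h'
  exact h.symm.port_eq h'.symm

theorem Link.lt (h : N.Link v p w q) : p < N.deg v := h.1

theorem Link.deliver (h : N.Link v p w q) (f : V → ℕ → ℕ) : N.deliver f v p = f w q := by
  have hp := h.lt
  obtain rfl := h.node_eq (link_backPort v ⟨p, hp⟩)
  obtain rfl := h.back_eq (link_backPort v ⟨p, hp⟩)
  rw [Network.deliver, dif_pos hp]

theorem deliver_ne_zero {f : V → ℕ → ℕ} (h : N.deliver f v p ≠ 0) :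
    ∃ w q, N.Link v p w q ∧ N.deliver f v p = f w q := by
  by_cases hp : p < N.deg v
  · obtain ⟨w, q, hl⟩ := exists_link_of_lt hp
    exact ⟨w, q, hl, hl.deliver f⟩
  · exact absurd (dif_neg hp) h

theorem deg_lt_card [Fintype V] (v : V) : N.deg v < Fintype.card V := by
  classical
  have : Fintype.card (Fin (N.deg v)) < Fintype.card V := by
    refine Fintype.card_lt_of_injective_of_notMem (N.nbr v) (nbr_injective v) (b := v) ?_
    rintro ⟨p, hp⟩
    exact (N.adj_nbr v p).ne hp.symm
  simpa using this

end Network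

/-! ### Gossip -/

/-- Some element of a finite set of numbers, or `0` if the set is empty. -/
noncomputable def anyOf (A : Finset ℕ) : ℕ := if h : A.Nonempty then h.choose else 0

theorem anyOf_mem {A : Finset ℕ} (h : A.Nonempty) : anyOf A ∈ A := by
  rw [anyOf, dif_pos h]
  exact h.choose_spec

/-- The numbers received through the first `deg` ports. -/
def received (deg : ℕ) (inb : ℕ → ℕ) : Finset ℕ := ((Finset.range deg).image inb).erase 0

/-- For the given number of rounds, send to all neighbours a known item that has not been sent yet,
and collect the items received. -/
noncomputable def gossip (deg : ℕ) (k : Finset ℕ → Prog) :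
    ℕ → Finset ℕ × Finset ℕ → Prog
  | 0, s => k s.1
  | T + 1, s => .step (fun _ => anyOf (s.1 \ s.2)) fun inb =>
      -- An idle node has `anyOf ∅ = 0`, which means silence and must not count as a sent item.
      gossip deg k T (s.1 ∪ received deg inb, (insert (anyOf (s.1 \ s.2)) s.2).erase 0)

variable {V : Type} (N : Network V)

/-- One round of gossip; the state of a node consists of the known and of the sent items. -/
noncomputable def gossipStep (s : V → Finset ℕ × Finset ℕ) (v : V) : Finset ℕ × Finset ℕ :=
  ((s v).1 ∪ received (N.deg v) (N.deliver (fun u _ => anyOf ((s u).1 \ (s u).2)) v),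
    (insert (anyOf ((s v).1 \ (s v).2)) (s v).2).erase 0)

/-- The states after `T` rounds of gossip. -/
noncomputable def gossipState (items : V → Finset ℕ) (T : ℕ) : V → Finset ℕ × Finset ℕ :=
  (gossipStep N)^[T] fun v => (items v, ∅)

theorem exec_gossip_aux {Q t : ℕ} (hQ : 0 < Q) {k : V → Finset ℕ → Prog} {out : V → Answer}
    (T : ℕ) : ∀ s : V → Finset ℕ × Finset ℕ, (∀ v, ∀ y ∈ (s v).1, y < Q) →
      Exec N Q t (fun v => k v (((gossipStep N)^[T] s) v).1) out →
      Exec N Q (T + t) (fun v => gossip (N.deg v) (k v) T (s v)) out := by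
  have hany : ∀ s : V → Finset ℕ × Finset ℕ, (∀ v, ∀ y ∈ (s v).1, y < Q) →
      ∀ v, anyOf ((s v).1 \ (s v).2) < Q := by
    intro s hs v
    by_cases h : ((s v).1 \ (s v).2).Nonempty
    · exact hs v _ (Finset.mem_sdiff.1 (anyOf_mem h)).1
    · rwa [anyOf, dif_neg h]
  induction T with
  | zero => intro s _ h; simpa [gossip] using h
  | succ T ih =>
    intro s hs h
    rw [Nat.add_right_comm]
    refine Exec.step (fun v _ => anyOf ((s v).1 \ (s v).2)) _ (fun v _ _ => hany s hs v)
      (ih (gossipStep N s) ?_ h)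
    intro v y hy
    rcases Finset.mem_union.1 hy with hy | hy
    · exact hs v y hy
    · obtain ⟨hy0, hy⟩ := Finset.mem_erase.1 hy
      obtain ⟨p, _, rfl⟩ := Finset.mem_image.1 hy
      obtain ⟨w, q, _, h2⟩ := Network.deliver_ne_zero hy0
      rw [h2]
      exact hany s hs w

theorem exec_gossip {Q t : ℕ} (hQ : 0 < Q) {k : V → Finset ℕ → Prog} {out : V → Answer}
    (T : ℕ) (items : V → Finset ℕ) (hs : ∀ v, ∀ y ∈ items v, y < Q)
    (h : Exec N Q t (fun v => k v (gossipState N items T v).1) out) :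
    Exec N Q (T + t) (fun v => gossip (N.deg v) (k v) T (items v, ∅)) out :=
  exec_gossip_aux N hQ T (fun v => (items v, ∅)) hs h

variable {N} {items : V → Finset ℕ}

theorem gossipState_succ (T : ℕ) :
    gossipState N items (T + 1) = gossipStep N (gossipState N items T) :=
  Function.iterate_succ_apply' _ _ _

theorem gossipState_snd_subset (T : ℕ) (v : V) :
    (gossipState N items T v).2 ⊆ (gossipState N items T v).1 := by
  induction T with
  | zero => simp [gossipState]
  | succ T ih =>
    rw [gossipState_succ]
    intro y hy
    obtain ⟨hy0, hy⟩ := Finset.mem_erase.1 hy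
    refine Finset.mem_union_left _ ?_
    rcases Finset.mem_insert.1 hy with rfl | hy
    · by_cases h : ((gossipState N items T v).1 \ (gossipState N items T v).2).Nonempty
      · exact (Finset.mem_sdiff.1 (anyOf_mem h)).1
      · exact absurd (dif_neg h) hy0
    · exact ih hy

theorem gossipState_fst_mono {T T' : ℕ} (h : T ≤ T') (v : V) :
    (gossipState N items T v).1 ⊆ (gossipState N items T' v).1 := by
  induction h with
  | refl => exact subset_rfl
  | step _ ih =>
    rw [gossipState_succ]
    exact ih.trans Finset.subset_union_left

/-- Only the items of the nodes are spread. -/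
theorem exists_mem_items {T : ℕ} : ∀ {v : V} {y : ℕ}, y ∈ (gossipState N items T v).1 →
    ∃ u, y ∈ items u := by
  induction T with
  | zero => intro v y h; exact ⟨v, h⟩
  | succ T ih =>
    intro v y h
    rw [gossipState_succ] at h
    rcases Finset.mem_union.1 h with hy | hy
    · exact ih hy
    · obtain ⟨hy0, hy⟩ := Finset.mem_erase.1 hy
      obtain ⟨p, _, rfl⟩ := Finset.mem_image.1 hy
      obtain ⟨w, q, _, h2⟩ := Network.deliver_ne_zero hy0
      rw [h2] at hy0 ⊢
      by_cases h : ((gossipState N items T w).1 \ (gossipState N items T w).2).Nonempty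
      · exact ih (Finset.mem_sdiff.1 (anyOf_mem h)).1
      · exact absurd (dif_neg h) hy0

theorem gossipState_snd_subset_of_adj {v x : V} (h : N.graph.Adj v x) (T : ℕ) :
    (gossipState N items T x).2 ⊆ (gossipState N items T v).1 := by
  obtain ⟨p, q, hl⟩ := Network.exists_link_of_adj h
  induction T with
  | zero => simp [gossipState]
  | succ T ih =>
    intro y hy
    rw [gossipState_succ] at hy ⊢
    obtain ⟨hy0, hy⟩ := Finset.mem_erase.1 hy
    rcases Finset.mem_insert.1 hy with rfl | hy
    · refine Finset.mem_union_right _ (Finset.mem_erase.2 ⟨hy0, Finset.mem_image.2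
        ⟨p, Finset.mem_range.2 hl.lt, hl.deliver _⟩⟩)
    · exact Finset.mem_union_left _ (ih hy)

/-- Along a walk of length `d`, an item arrives within `d` rounds, plus one for each known item. -/
theorem items_subset_or_le_card (h0 : ∀ v, 0 ∉ items v) {v u : V} (w : N.graph.Walk v u) :
    ∀ T : ℕ, items u ⊆ (gossipState N items T v).1 ∨
      T + 1 ≤ (gossipState N items T v).1.card + w.length := by
  have hzero : ∀ (T : ℕ) (v : V), 0 ∉ (gossipState N items T v).1 := fun T v h => by
    obtain ⟨u, hu⟩ := exists_mem_items h
    exact h0 u hu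
  induction w with
  | nil => exact fun T => Or.inl (gossipState_fst_mono (Nat.zero_le T) _)
  | @cons v x u hadj w ih =>
    -- The bound is first shown for the items already sent by the neighbour `x`. In each round `x`
    -- either sends a new item, which pays for the round, or it is idle. When idle it has sent all
    -- it knows, and the induction hypothesis for the shorter walk applies to these items.
    have hsent : ∀ T : ℕ, items u ⊆ (gossipState N items T x).2 ∨
        T + 1 ≤ (gossipState N items T x).2.card + (w.length + 1) := by
      intro T
      induction T with
      | zero => exact Or.inr (by omega)
      | succ T ihT =>
        set s := gossipState N items T x with hs
        have hsub : s.2 ⊆ s.1 := gossipState_snd_subset T x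
        have hnext : (gossipState N items (T + 1) x).2
            = (insert (anyOf (s.1 \ s.2)) s.2).erase 0 := by rw [gossipState_succ]; rfl
        have h02 : 0 ∉ s.2 := fun h => hzero T x (hsub h)
        rw [hnext]
        have hgrow : s.2 ⊆ (insert (anyOf (s.1 \ s.2)) s.2).erase 0 := fun y hy =>
          Finset.mem_erase.2 ⟨fun h => h02 (h ▸ hy), Finset.mem_insert_of_mem hy⟩
        rcases ihT with h | h
        · exact Or.inl (h.trans hgrow)
        · by_cases hne : (s.1 \ s.2).Nonempty
          · obtain ⟨hm1, hm2⟩ := Finset.mem_sdiff.1 (anyOf_mem hne)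
            have hne0 : anyOf (s.1 \ s.2) ≠ 0 := fun h => hzero T x (h ▸ hm1)
            rw [Finset.erase_eq_of_notMem (by simp [hne0.symm, h02]),
              Finset.card_insert_of_notMem hm2]
            right; omega
          · have heq : s.2 = s.1 := hsub.antisymm
              (Finset.sdiff_eq_empty_iff_subset.1 (Finset.not_nonempty_iff_eq_empty.1 hne))
            have hc := Finset.card_le_card hgrow
            rcases ih T with h' | h'
            · exact Or.inl ((heq ▸ h').trans hgrow)
            · rw [← hs, ← heq] at h'
              right; omega
    intro T
    have hsub := gossipState_snd_subset_of_adj (items := items) hadj T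
    rcases hsent T with h | h
    · exact Or.inl (h.trans hsub)
    · right
      have := Finset.card_le_card hsub
      rw [SimpleGraph.Walk.length_cons]
      omega

/-- All items of the network. -/
noncomputable def allItems [Fintype V] (items : V → Finset ℕ) : Finset ℕ :=
  Finset.univ.biUnion items

theorem gossipState_fst_subset_allItems [Fintype V] (T : ℕ) (v : V) :
    (gossipState N items T v).1 ⊆ allItems items := fun y hy => by
  obtain ⟨u, hu⟩ := exists_mem_items hy
  exact Finset.mem_biUnion.2 ⟨u, Finset.mem_univ u, hu⟩

/-- If an item were still missing after so many rounds, `v` would know more items than exist. -/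
theorem gossipState_fst_eq_allItems [Fintype V] (h0 : ∀ v, 0 ∉ items v) {T D : ℕ} {v : V}
    (hw : ∀ u, ∃ w : N.graph.Walk v u, w.length ≤ D) (hT : (allItems items).card + D ≤ T) :
    (gossipState N items T v).1 = allItems items := by
  refine (gossipState_fst_subset_allItems T v).antisymm fun y hy => ?_
  obtain ⟨u, _, hu⟩ := Finset.mem_biUnion.1 hy
  obtain ⟨w, hwD⟩ := hw u
  rcases items_subset_or_le_card h0 w T with h | h
  · exact h hu
  · have := Finset.card_le_card (gossipState_fst_subset_allItems (N := N) (items := items) T v)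
    omega

/-! ### A greedy matching -/

/-- A port through which the smallest nonzero number was received. -/
noncomputable def minPort (inb : ℕ → ℕ) : Option ℕ :=
  open Classical in
  if h : ∃ p, inb p ≠ 0 ∧ ∀ p', inb p' ≠ 0 → inb p ≤ inb p' then some h.choose else none

theorem minPort_spec {inb : ℕ → ℕ} {p : ℕ} (h : minPort inb = some p) :
    inb p ≠ 0 ∧ ∀ p', inb p' ≠ 0 → inb p ≤ inb p' := by
  unfold minPort at h
  split_ifs at h with h'
  rw [← Option.some_inj.1 h]
  exact h'.choose_spec

theorem exists_minPort {inb : ℕ → ℕ} {p : ℕ} (hp : inb p ≠ 0) : ∃ p, minPort inb = some p := by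
  have h : ∃ p, inb p ≠ 0 ∧ ∀ p', inb p' ≠ 0 → inb p ≤ inb p' := by
    obtain ⟨y, ⟨p, hp, rfl⟩, hmin⟩ := WellFounded.has_min (wellFounded_lt (α := ℕ))
      {y | ∃ p, inb p ≠ 0 ∧ inb p = y} ⟨_, p, hp, rfl⟩
    exact ⟨p, hp, fun p' hp' => not_lt.1 (hmin _ ⟨p', hp', rfl⟩)⟩
  exact ⟨_, dif_pos h⟩

/-- The new matching port of a node which has received `inb` from the offers and `inb'` from the
proposals of its neighbours. -/
noncomputable def rematch (s : Option ℕ) (inb inb' : ℕ → ℕ) : Option ℕ :=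
  if s = none then (minPort inb).filter fun p => inb' p ≠ 0 else s

/-- The given number of times, a free node proposes to its free neighbour of smallest identifier;
a mutual proposal becomes a matching edge. -/
noncomputable def greedy (ident : ℕ) (k : Option ℕ → Prog) : ℕ → Option ℕ → Prog
  | 0, s => k s
  | T + 1, s => .step (fun _ => if s = none then ident + 1 else 0) fun inb =>
      .step (fun p => if s = none ∧ minPort inb = some p then 1 else 0) fun inb' =>
        greedy ident k T (rematch s inb inb')

variable {V : Type} (N : Network V)

/-- The identifiers of the free nodes, increased by one, as sent by these nodes. -/
noncomputable def offer (s : V → Option ℕ) (v : V) (_ : ℕ) : ℕ :=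
  if s v = none then N.id v + 1 else 0

/-- The proposals of the free nodes. -/
noncomputable def proposal (s : V → Option ℕ) (v : V) (p : ℕ) : ℕ :=
  if s v = none ∧ minPort (N.deliver (offer N s) v) = some p then 1 else 0

/-- One iteration of the greedy algorithm. -/
noncomputable def greedyStep (s : V → Option ℕ) (v : V) : Option ℕ :=
  rematch (s v) (N.deliver (offer N s) v) (N.deliver (proposal N s) v)

theorem exec_greedy {Q t : ℕ} (hQ : ∀ v, N.id v + 1 < Q) {k : V → Option ℕ → Prog}
    {out : V → Answer} (T : ℕ) : ∀ s : V → Option ℕ,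
      Exec N Q t (fun v => k v (((greedyStep N)^[T] s) v)) out →
      Exec N Q (2 * T + t) (fun v => greedy (N.id v) (k v) T (s v)) out := by
  induction T with
  | zero => intro s h; simpa [greedy] using h
  | succ T ih =>
    intro s h
    rw [show 2 * (T + 1) + t = (2 * T + t) + 1 + 1 by ring]
    refine Exec.step (offer N s) _ (fun v p _ => ?_)
      (Exec.step (proposal N s) _ (fun v p _ => ?_) (ih (greedyStep N s) h))
    · have := hQ v
      unfold offer
      split_ifs <;> omega
    · have := hQ v
      unfold proposal
      split_ifs <;> omega

/-- The matching ports of the two ends of every edge agree. -/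
def Paired (s : V → Option ℕ) : Prop :=
  ∀ v p, s v = some p → ∃ w q, N.Link v p w q ∧ s w = some q

/-- Every edge has an end which is matched. -/
def Saturated (s : V → Option ℕ) : Prop :=
  ∀ v w, N.graph.Adj v w → s v = none → s w ≠ none

/-- The matched nodes. -/
noncomputable def matchedNodes [Fintype V] (s : V → Option ℕ) : Finset V :=
  open Classical in Finset.univ.filter fun v => s v ≠ none

variable {N} {s : V → Option ℕ}

theorem greedyStep_of_some {v : V} {p : ℕ} (h : s v = some p) : greedyStep N s v = some p := by
  simp [greedyStep, rematch, h]

theorem greedyStep_of_link {v w : V} {p q : ℕ} (hl : N.Link v p w q) (hv : s v = none)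
    (hw : s w = none) (hp : minPort (N.deliver (offer N s) v) = some p)
    (hq : minPort (N.deliver (offer N s) w) = some q) : greedyStep N s v = some p := by
  have : N.deliver (proposal N s) v p ≠ 0 := by
    rw [hl.deliver, proposal, if_pos ⟨hw, hq⟩]
    exact one_ne_zero
  rw [greedyStep, rematch, if_pos hv, hp, Option.filter_some, if_pos (by simpa using this)]

theorem eq_or_of_greedyStep {v : V} {p : ℕ} (h : greedyStep N s v = some p) :
    s v = some p ∨ ∃ w q, N.Link v p w q ∧ s v = none ∧ s w = none ∧
      minPort (N.deliver (offer N s) v) = some p ∧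
      minPort (N.deliver (offer N s) w) = some q := by
  by_cases hv : s v = none
  · right
    rw [greedyStep, rematch, if_pos hv, Option.filter_eq_some_iff] at h
    obtain ⟨hp, h⟩ := h
    have h : N.deliver (proposal N s) v p ≠ 0 := by simpa using h
    obtain ⟨w, q, hl, h2⟩ := Network.deliver_ne_zero h
    rw [h2, proposal] at h
    split_ifs at h with h3
    · exact ⟨w, q, hl, hv, h3.1, hp, h3.2⟩
    · exact absurd rfl h
  · left
    rwa [greedyStep, rematch, if_neg hv] at h

theorem Paired.greedyStep (hs : Paired N s) : Paired N (greedyStep N s) := by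
  intro v p h
  rcases eq_or_of_greedyStep h with h | ⟨w, q, hl, hv, hw, hp, hq⟩
  · obtain ⟨w, q, hl, hw⟩ := hs v p h
    exact ⟨w, q, hl, greedyStep_of_some hw⟩
  · exact ⟨w, q, hl, greedyStep_of_link hl.symm hw hv hq hp⟩

/-- Let `u` have the smallest identifier among the free nodes with a free neighbour, and let `w` be
the smallest free neighbour of `u`. Every free neighbour of `w` competes with `u` in this minimum,
so `w` proposes to `u` and the proposal is mutual. -/
theorem exists_greedyStep_of_not_saturated [Finite V] (h : ¬ Saturated N s) :
    ∃ u w, u ≠ w ∧ s u = none ∧ s w = none ∧ greedyStep N s u ≠ none ∧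
      greedyStep N s w ≠ none := by
  classical
  simp only [Saturated, not_forall, not_not] at h
  obtain ⟨v₀, w₀, h₀, hv₀, hw₀⟩ := h
  obtain ⟨u, ⟨w₁, hadj₁, hu, hw₁⟩, hmin⟩ := Set.exists_min_image
    {u | ∃ w, N.graph.Adj u w ∧ s u = none ∧ s w = none} N.id (Set.toFinite _)
    ⟨v₀, w₀, h₀, hv₀, hw₀⟩
  have hoff : ∀ {a b : V} {p q : ℕ}, N.Link a p b q → s b = none →
      N.deliver (offer N s) a p = N.id b + 1 := fun hl hb => by
    rw [hl.deliver, offer, if_pos hb]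
  have hinv : ∀ {a : V} {p : ℕ}, N.deliver (offer N s) a p ≠ 0 →
      ∃ b q, N.Link a p b q ∧ s b = none := fun {a p} hne => by
    obtain ⟨b, q, hl, h2⟩ := Network.deliver_ne_zero hne
    refine ⟨b, q, hl, ?_⟩
    by_contra hb
    rw [h2, offer, if_neg hb] at hne
    exact hne rfl
  obtain ⟨p₁, q₁, hl₁⟩ := Network.exists_link_of_adj hadj₁
  obtain ⟨p, hp⟩ := exists_minPort (inb := N.deliver (offer N s) u) (p := p₁)
    (by rw [hoff hl₁ hw₁]; omega)
  obtain ⟨w, q, hl, hw⟩ := hinv (minPort_spec hp).1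
  obtain ⟨q', hq'⟩ := exists_minPort (inb := N.deliver (offer N s) w) (p := q)
    (by rw [hoff hl.symm hu]; omega)
  obtain ⟨u', r, hl', hu'⟩ := hinv (minPort_spec hq').1
  have hle := (minPort_spec hq').2 q (by rw [hoff hl.symm hu]; omega)
  rw [hoff hl.symm hu, hoff hl' hu'] at hle
  have hge := hmin u' ⟨w, hl'.symm.adj, hu', hw⟩
  obtain rfl : u' = u := N.id_injective (by omega)
  obtain rfl := hl'.port_eq hl.symm
  refine ⟨u', w, hl.adj.ne, hu, hw, ?_, ?_⟩
  · rw [greedyStep_of_link hl hu hw hp hq']; simp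
  · rw [greedyStep_of_link hl.symm hw hu hq' hp]; simp

variable (N) in
/-- The matching computed by `T` iterations of the greedy algorithm. -/
noncomputable def greedyMatching (T : ℕ) : V → Option ℕ := (greedyStep N)^[T] fun _ => none

theorem paired_greedyMatching (T : ℕ) : Paired N (greedyMatching N T) := by
  induction T with
  | zero => intro v p h; simp [greedyMatching] at h
  | succ T ih =>
    rw [greedyMatching, Function.iterate_succ_apply']
    exact ih.greedyStep

/-- Saturation persists, and every iteration that ends unsaturated has started unsaturated and hence
has matched two new nodes. -/
theorem saturated_or_card_le [Fintype V] (T : ℕ) :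
    Saturated N (greedyMatching N T) ∨ 2 * T ≤ (matchedNodes (greedyMatching N T)).card := by
  classical
  induction T with
  | zero => simp
  | succ T ih =>
    rw [greedyMatching, Function.iterate_succ_apply']
    change Saturated N (greedyStep N (greedyMatching N T)) ∨ _ ≤ (matchedNodes
      (greedyStep N (greedyMatching N T))).card
    set s := greedyMatching N T
    have hmono : ∀ v, s v ≠ none → greedyStep N s v ≠ none := by
      intro v hv
      obtain ⟨p, hp⟩ := Option.ne_none_iff_exists'.1 hv
      rw [greedyStep_of_some hp]
      simp
    by_cases hsat : Saturated N s
    · refine Or.inl fun v w hvw hv => hmono w (hsat v w hvw ?_)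
      by_contra h
      exact hmono v h hv
    · right
      have ih := ih.resolve_left hsat
      obtain ⟨u, w, huw, hu, hw, hu', hw'⟩ := exists_greedyStep_of_not_saturated hsat
      have hsub : insert u (insert w (matchedNodes s)) ⊆ matchedNodes (greedyStep N s) := by
        intro x hx
        simp only [matchedNodes, Finset.mem_insert, Finset.mem_filter, Finset.mem_univ,
          true_and] at hx ⊢
        rcases hx with rfl | rfl | hx
        exacts [hu', hw', hmono x hx]
      have := Finset.card_le_card hsub
      rw [Finset.card_insert_of_notMem (by simp [matchedNodes, huw, hu]),
        Finset.card_insert_of_notMem (by simp [matchedNodes, hw])] at this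
      omega

/-! ### Distances and vertex covers -/

open Classical in
/-- In a connected graph, either every node is within distance `2 * L` of `v`, or a vertex cover
contains at least `L` nodes within this distance. -/
theorem forall_walk_or_exists_cover {V : Type} {G : SimpleGraph V} (hG : G.Connected)
    {X : Finset V} (hX : ∀ v w, G.Adj v w → v ∈ X ∨ w ∈ X) (L : ℕ) (v : V) :
    (∀ u, ∃ w : G.Walk v u, w.length ≤ 2 * L) ∨
      ∃ Y : Finset V, Y ⊆ X ∧ L ≤ Y.card ∧ ∀ u ∈ Y, ∃ w : G.Walk v u, w.length ≤ 2 * L := by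
  by_cases h : ∀ u, G.dist v u ≤ 2 * L
  · left
    intro u
    obtain ⟨w, hw⟩ := hG.exists_walk_length_eq_dist v u
    exact ⟨w, hw ▸ h u⟩
  right
  push Not at h
  obtain ⟨u, hu⟩ := h
  obtain ⟨p, hp⟩ := hG.exists_walk_length_eq_dist v u
  have hdist : ∀ j ≤ p.length, G.dist v (p.getVert j) = j := by
    intro j hj
    have h1 := SimpleGraph.dist_le (p.take j)
    have h2 := SimpleGraph.dist_le (p.drop j)
    have h3 := hG.dist_triangle (u := v) (v := p.getVert j) (w := u)
    rw [SimpleGraph.Walk.take_length] at h1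
    rw [SimpleGraph.Walk.drop_length] at h2
    omega
  -- The vertices 2i and 2i + 1 of a shortest path span an edge, so one of them is in the cover; its
  -- distance from `v` identifies i.
  have hex : ∀ i, ∃ y, i < L → y ∈ X ∧ (G.dist v y = 2 * i ∨ G.dist v y = 2 * i + 1) := by
    intro i
    by_cases hi : i < L
    · rcases hX _ _ (p.adj_getVert_succ (i := 2 * i) (by omega)) with h | h
      · exact ⟨_, fun _ => ⟨h, Or.inl (hdist _ (by omega))⟩⟩
      · exact ⟨_, fun _ => ⟨h, Or.inr (hdist _ (by omega))⟩⟩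
    · exact ⟨v, fun h => absurd h hi⟩
  choose y hy using hex
  refine ⟨(Finset.range L).image y, ?_, ?_, ?_⟩
  · intro x hx
    obtain ⟨i, hi, rfl⟩ := Finset.mem_image.1 hx
    exact (hy i (Finset.mem_range.1 hi)).1
  · rw [Finset.card_image_of_injOn, Finset.card_range]
    intro i hi j hj hij
    have h1 := (hy i (by simpa using hi)).2
    have h2 := (hy j (by simpa using hj)).2
    simp only [hij] at h1
    omega
  · intro x hx
    obtain ⟨i, hi, rfl⟩ := Finset.mem_image.1 hx
    obtain ⟨w, hw⟩ := hG.exists_walk_length_eq_dist v (y i)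
    have := (hy i (Finset.mem_range.1 hi)).2
    have := Finset.mem_range.1 hi
    exact ⟨w, by omega⟩

/-! ### Matchings -/

theorem two_mul_ncard_edgeSet {V : Type} [Fintype V] {G : SimpleGraph V} {M : G.Subgraph}
    (hM : M.IsMatching) : 2 * M.edgeSet.ncard = M.verts.ncard := by
  classical
  have h := M.spanningCoe.sum_degrees_eq_twice_card_edges
  have h1 : ∀ v, M.spanningCoe.degree v = if v ∈ M.verts then 1 else 0 := by
    intro v
    rw [SimpleGraph.Subgraph.degree_spanningCoe]
    split_ifs with hv
    · exact SimpleGraph.Subgraph.isMatching_iff_forall_degree.1 hM v hv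
    · exact SimpleGraph.Subgraph.degree_of_notMem_verts hv
  rw [Finset.sum_congr rfl fun v _ => h1 v, Finset.sum_boole] at h
  rw [Set.ncard_eq_toFinset_card', Set.ncard_eq_toFinset_card']
  have h2 : M.edgeSet.toFinset = M.spanningCoe.edgeFinset := by
    ext e; simp
  have h3 : M.verts.toFinset = Finset.univ.filter fun v => v ∈ M.verts := by
    ext e; simp
  rw [h2, h3, ← h]
  simp

/-- The matching given by a symmetric partial function. -/
def matchingOf {V : Type} {G : SimpleGraph V} (R : V → V → Prop) (hR : ∀ v w, R v w → G.Adj v w)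
    (hsymm : ∀ v w, R v w → R w v) : G.Subgraph where
  verts := {v | ∃ w, R v w}
  Adj := R
  adj_sub := hR _ _
  edge_vert h := ⟨_, h⟩
  symm := ⟨hsymm⟩

theorem isMatching_matchingOf {V : Type} {G : SimpleGraph V} {R : V → V → Prop}
    (hR : ∀ v w, R v w → G.Adj v w) (hsymm : ∀ v w, R v w → R w v)
    (hfun : ∀ v w w', R v w → R v w' → w = w') : (matchingOf R hR hsymm).IsMatching := by
  rintro v ⟨w, hw⟩
  exact ⟨w, hw, fun w' hw' => hfun v w' w hw' hw⟩

open Classical in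
/-- A fixed-point-free involution of a finite set has invariant subsets of all even sizes. -/
theorem exists_invariant_subset {α : Type} {X : Finset α} {f : α → α} (hf : ∀ a ∈ X, f a ∈ X)
    (hff : ∀ a ∈ X, f (f a) = a) (hne : ∀ a ∈ X, f a ≠ a) (j : ℕ) (hj : 2 * j ≤ X.card) :
    ∃ A ⊆ X, A.card = 2 * j ∧ ∀ a ∈ X, (f a ∈ A ↔ a ∈ A) := by
  induction j with
  | zero => exact ⟨∅, by simp, by simp, by simp⟩
  | succ j ih =>
    obtain ⟨A, hAX, hA, hinv⟩ := ih (by omega)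
    obtain ⟨x, hx, hxA⟩ := Finset.exists_mem_notMem_of_card_lt_card (show A.card < X.card by omega)
    have hfxA : f x ∉ A := fun h => hxA ((hinv x hx).1 h)
    refine ⟨insert x (insert (f x) A), ?_, ?_, ?_⟩
    · exact Finset.insert_subset hx (Finset.insert_subset (hf x hx) hAX)
    · rw [Finset.card_insert_of_notMem, Finset.card_insert_of_notMem hfxA, hA]
      · omega
      · simp [hxA, (hne x hx).symm]
    · intro a ha
      have h1 : f a = x ↔ a = f x :=
        ⟨fun h => by rw [← h, hff a ha], fun h => by rw [h, hff x hx]⟩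
      have h2 : f a = f x ↔ a = x :=
        ⟨fun h => by rw [← hff a ha, h, hff x hx], fun h => by rw [h]⟩
      rw [Finset.mem_insert, Finset.mem_insert, Finset.mem_insert, Finset.mem_insert, hinv a ha,
        h1, h2]
      tauto

/-! ### Disjoint arcs and the exchange argument -/

/-- The arcs in `F` are pairwise disjoint. -/
def ArcDisjoint {α : Type} (F : Finset (α × α)) : Prop :=
  ∀ e ∈ F, ∀ e' ∈ F, e ≠ e' → e.1 ≠ e'.1 ∧ e.1 ≠ e'.2 ∧ e.2 ≠ e'.1 ∧ e.2 ≠ e'.2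

namespace ArcDisjoint

variable {α β : Type} {F : Finset (α × α)}

theorem mono {F' : Finset (α × α)} (h : ArcDisjoint F) (hF : F' ⊆ F) : ArcDisjoint F' :=
  fun e he e' he' => h e (hF he) e' (hF he')

theorem injOn_fst (h : ArcDisjoint F) : Set.InjOn Prod.fst (F : Set (α × α)) := by
  intro e he e' he' heq
  by_contra hne
  exact (h e he e' he' hne).1 heq

/-- The image of pairwise disjoint arcs under a map that is injective on their ends. -/
theorem image [DecidableEq β] (h : ArcDisjoint F) (f : α → β)
    (hf : ∀ a b, (∃ e ∈ F, a = e.1 ∨ a = e.2) → (∃ e ∈ F, b = e.1 ∨ b = e.2) → f a = f b → a = b) :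
    ArcDisjoint (F.image (Prod.map f f)) ∧ (F.image (Prod.map f f)).card = F.card := by
  constructor
  · intro e he e' he' hne
    obtain ⟨e, heF, rfl⟩ := Finset.mem_image.1 he
    obtain ⟨e', heF', rfl⟩ := Finset.mem_image.1 he'
    obtain ⟨h1, h2, h3, h4⟩ := h e heF e' heF' (by rintro rfl; exact hne rfl)
    refine ⟨fun h => h1 ?_, fun h => h2 ?_, fun h => h3 ?_, fun h => h4 ?_⟩ <;>
      exact hf _ _ ⟨e, heF, by tauto⟩ ⟨e', heF', by tauto⟩ h
  · refine Finset.card_image_of_injOn fun e he e' he' heq => h.injOn_fst he he' ?_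
    exact hf _ _ ⟨e, he, by tauto⟩ ⟨e', he', by tauto⟩ (Prod.ext_iff.1 heq).1

variable [DecidableEq α]

/-- Each such arc is charged to an end in `S`; by disjointness no node is charged twice. -/
theorem card_touching_le (h : ArcDisjoint F) (S : Finset α) :
    (F.filter fun e => e.1 ∈ S ∨ e.2 ∈ S).card ≤ S.card := by
  refine Finset.card_le_card_of_injOn (fun e => if e.1 ∈ S then e.1 else e.2) ?_ ?_
  · intro e he
    have := (Finset.mem_filter.1 he).2
    by_cases h1 : e.1 ∈ S
    · simp [h1]
    · simpa [h1] using this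
  · intro e he e' he' heq
    by_contra hne
    have := h e (Finset.mem_filter.1 he).1 e' (Finset.mem_filter.1 he').1 hne
    dsimp only at heq
    split_ifs at heq <;> tauto

/-- Pairwise disjoint arcs can be replaced by as many arcs with the same tails whose heads are in
prescribed sets, if these are either harmless or large. -/
theorem exists_kept {C : Finset α} (keep : α → Finset α) (n : ℕ) : ∀ F : Finset (α × α),
    (F.filter fun e => e.2 ∉ keep e.1).card = n → ArcDisjoint F →
    (∀ e ∈ F, e.1 ∈ C ∧ e.1 ≠ e.2 ∧ (e.2 ∈ keep e.1 ∨ 2 * C.card ≤ (keep e.1).card)) →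
    ∃ F', F'.card = F.card ∧ ArcDisjoint F' ∧ ∀ e ∈ F', e.1 ∈ C ∧ e.1 ≠ e.2 ∧ e.2 ∈ keep e.1 := by
  induction n with
  | zero =>
    intro F hn hF hC
    refine ⟨F, rfl, hF, fun e he => ⟨(hC e he).1, (hC e he).2.1, ?_⟩⟩
    by_contra h
    exact Finset.notMem_empty e (Finset.card_eq_zero.1 hn ▸ Finset.mem_filter.2 ⟨he, h⟩)
  | succ n ih =>
    intro F hn hF hC
    obtain ⟨⟨a, b⟩, hab⟩ := Finset.card_pos.1 (show 0 < (F.filter fun e => e.2 ∉ keep e.1).card by omega)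
    obtain ⟨heF, hb⟩ := Finset.mem_filter.1 hab
    dsimp only at hb
    obtain ⟨haC, hne, hlarge⟩ := hC _ heF
    have hlarge := hlarge.resolve_left hb
    dsimp only at haC hne hlarge
    set U := F.image Prod.fst ∪ F.image Prod.snd with hU
    have hbU : b ∈ U := Finset.mem_union_right _ (Finset.mem_image.2 ⟨_, heF, rfl⟩)
    have hFC : F.card ≤ C.card :=
      Finset.card_le_card_of_injOn Prod.fst (fun e he => (hC e he).1) hF.injOn_fst
    have hUcard : U.card ≤ 2 * C.card := by
      refine (Finset.card_union_le _ _).trans ?_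
      have h1 := Finset.card_image_le (s := F) (f := Prod.fst)
      have h2 := Finset.card_image_le (s := F) (f := Prod.snd)
      omega
    -- At most 2|C| nodes are in use, and one of them, `b`, is not in `keep a`. So the 2|C| elements
    -- of `keep a` do not all fit into `U`, and the arc can be redirected to a fresh head.
    obtain ⟨b', hb'K, hb'U⟩ : ∃ b' ∈ keep a, b' ∉ U := by
      by_contra hcon
      push Not at hcon
      have : keep a ⊆ U.erase b := fun x hx =>
        Finset.mem_erase.2 ⟨fun h => hb (h ▸ hx), hcon x hx⟩
      have := Finset.card_le_card this
      rw [Finset.card_erase_of_mem hbU] at this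
      have := Finset.card_pos.2 ⟨b, hbU⟩
      omega
    have hfst : ∀ e ∈ F, b' ≠ e.1 := fun e he h =>
      hb'U (h ▸ Finset.mem_union_left _ (Finset.mem_image.2 ⟨e, he, rfl⟩))
    have hsnd : ∀ e ∈ F, b' ≠ e.2 := fun e he h =>
      hb'U (h ▸ Finset.mem_union_right _ (Finset.mem_image.2 ⟨e, he, rfl⟩))
    have hnot : (a, b') ∉ F.erase (a, b) := fun h => hsnd _ (Finset.mem_of_mem_erase h) rfl
    have hcount : ((insert (a, b') (F.erase (a, b))).filter fun e => e.2 ∉ keep e.1).card = n := by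
      rw [Finset.filter_insert, if_neg (not_not.2 hb'K), Finset.filter_erase,
        Finset.card_erase_of_mem hab, hn, Nat.add_sub_cancel]
    have hdisj : ArcDisjoint (insert (a, b') (F.erase (a, b))) := by
      intro e he e' he' hne'
      rcases Finset.mem_insert.1 he with rfl | he <;> rcases Finset.mem_insert.1 he' with rfl | he'
      · exact absurd rfl hne'
      · obtain ⟨hx, he'⟩ := Finset.mem_erase.1 he'
        have := hF _ heF e' he' hx.symm
        exact ⟨this.1, this.2.1, hfst e' he', hsnd e' he'⟩
      · obtain ⟨hx, he⟩ := Finset.mem_erase.1 he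
        have := hF e he _ heF hx
        exact ⟨this.1, (hfst e he).symm, this.2.2.1, (hsnd e he).symm⟩
      · exact hF e (Finset.mem_of_mem_erase he) e' (Finset.mem_of_mem_erase he') hne'
    obtain ⟨F', h1, h2, h3⟩ := ih _ hcount hdisj fun e he => by
      rcases Finset.mem_insert.1 he with rfl | he
      · exact ⟨haC, fun h => hfst _ heF h.symm, Or.inl hb'K⟩
      · exact hC e (Finset.mem_of_mem_erase he)
    refine ⟨F', ?_, h2, h3⟩
    rw [h1, Finset.card_insert_of_notMem hnot, Finset.card_erase_of_mem heF]
    have := Finset.card_pos.2 ⟨_, heF⟩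
    omega

theorem card_ends (h : ArcDisjoint F) (hne : ∀ e ∈ F, e.1 ≠ e.2) :
    (F.image Prod.fst ∪ F.image Prod.snd).card = 2 * F.card := by
  have hsnd : Set.InjOn Prod.snd (F : Set (α × α)) := by
    intro e he e' he' heq
    by_contra hne
    exact (h e he e' he' hne).2.2.2 heq
  rw [Finset.card_union_of_disjoint, Finset.card_image_of_injOn h.injOn_fst,
    Finset.card_image_of_injOn hsnd, two_mul]
  rw [Finset.disjoint_left]
  intro x hx hx'
  obtain ⟨e, he, rfl⟩ := Finset.mem_image.1 hx
  obtain ⟨e', he', heq⟩ := Finset.mem_image.1 hx'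
  by_cases hee : e = e'
  · exact hne e he (by rw [← heq, hee] )
  · exact (h e he e' he' hee).2.1 heq.symm

end ArcDisjoint

open Classical in
/-- The edges of a matching, oriented away from a vertex cover. -/
theorem exists_arcs_of_hasMatching {V : Type} [Fintype V] {G : SimpleGraph V} {k : ℕ}
    (h : HasMatching G k) {X : Finset V} (hX : ∀ v w, G.Adj v w → v ∈ X ∨ w ∈ X) :
    ∃ F : Finset (V × V), k ≤ F.card ∧ ArcDisjoint F ∧ ∀ e ∈ F, G.Adj e.1 e.2 ∧ e.1 ∈ X := by
  obtain ⟨M, hM, hk⟩ := h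
  have hex : ∀ e : Sym2 V, ∃ a : V × V, e ∈ M.edgeSet → s(a.1, a.2) = e ∧ a.1 ∈ X := by
    intro e
    by_cases he : e ∈ M.edgeSet
    · induction e with
      | _ v w =>
        rcases hX v w (M.adj_sub he) with h | h
        · exact ⟨(v, w), fun _ => ⟨rfl, h⟩⟩
        · exact ⟨(w, v), fun _ => ⟨Sym2.eq_swap, h⟩⟩
    · obtain ⟨v, w⟩ := e
      exact ⟨(v, v), fun h => absurd h he⟩
  choose f hf using hex
  have hmem : ∀ {e}, e ∈ M.edgeSet.toFinset → e ∈ M.edgeSet := fun h => Set.mem_toFinset.1 h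
  refine ⟨M.edgeSet.toFinset.image f, ?_, ?_, ?_⟩
  · rw [Finset.card_image_of_injOn]
    · rwa [← Set.ncard_eq_toFinset_card']
    · intro e he e' he' heq
      rw [← (hf e (hmem he)).1, ← (hf e' (hmem he')).1, heq]
  · intro a ha a' ha' hne
    obtain ⟨e, he, rfl⟩ := Finset.mem_image.1 ha
    obtain ⟨e', he', rfl⟩ := Finset.mem_image.1 ha'
    have h1 := (hf e (hmem he)).1
    have h2 := (hf e' (hmem he')).1
    have hadj : M.Adj (f e).1 (f e).2 := by
      have := hmem he; rw [← h1] at this; exact this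
    have hadj' : M.Adj (f e').1 (f e').2 := by
      have := hmem he'; rw [← h2] at this; exact this
    have key : ∀ {a b c : V}, M.Adj a b → M.Adj a c → b = c := fun h h' =>
      hM.eq_of_adj_left h h'
    have hee : e ≠ e' := fun h => hne (by rw [h])
    refine ⟨fun h => hee ?_, fun h => hee ?_, fun h => hee ?_, fun h => hee ?_⟩ <;> rw [← h1, ← h2]
    · rw [h] at hadj ⊢
      rw [key hadj hadj']
    · rw [h] at hadj ⊢
      rw [key hadj hadj'.symm, Sym2.eq_swap]
    · rw [h] at hadj ⊢
      rw [key hadj.symm hadj', Sym2.eq_swap]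
    · rw [h] at hadj ⊢
      rw [key hadj.symm hadj'.symm]
  · intro a ha
    obtain ⟨e, he, rfl⟩ := Finset.mem_image.1 ha
    have h1 := hf e (hmem he)
    have := hmem he
    rw [← h1.1] at this
    exact ⟨M.adj_sub this, h1.2⟩

/-! ### The algorithm -/

/-- The parameters of the algorithm: identifiers are below `n ^ c`; the aim is a matching of size `K`,
or a proof that there is no matching of size `K + m`; if `colored`, the nodes may be distinguished by
colors below `2 ^ l` instead of their identifiers. -/
structure Params where
  c : ℕ
  K : ℕ
  m : ℕ
  l : ℕ
  colored : Prop

/-- The item which a matched node spreads: its identifier, that of its mate, and its degree. -/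
def packItem (ident mate deg : ℕ) : ℕ := Nat.pair ident (Nat.pair mate deg) + 1

def itemId (y : ℕ) : ℕ := (y - 1).unpair.1

def itemMate (y : ℕ) : ℕ := (y - 1).unpair.2.unpair.1

def itemDeg (y : ℕ) : ℕ := (y - 1).unpair.2.unpair.2

@[simp] theorem itemId_packItem (i j d : ℕ) : itemId (packItem i j d) = i := by
  simp [itemId, packItem]

@[simp] theorem itemMate_packItem (i j d : ℕ) : itemMate (packItem i j d) = j := by
  simp [itemMate, packItem]

@[simp] theorem itemDeg_packItem (i j d : ℕ) : itemDeg (packItem i j d) = d := by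
  simp [itemDeg, packItem]

/-- The identifiers in a set of items. -/
def idsOf (H : Finset ℕ) : Finset ℕ := H.image itemId

/-- A number between `n` and `n ^ 2`, computed from the items of a maximal matching. -/
def sizeEstimate (H : Finset ℕ) : ℕ := ∑ y ∈ H, (itemDeg y + 1)

/-- `A` is the set of the ends of `m` edges of the matching described by `H`, or of all its edges if
there are less than `m`. -/
def IsSettled (m : ℕ) (H A : Finset ℕ) : Prop :=
  A ⊆ idsOf H ∧ A.card = min (2 * m) H.card ∧ ∀ y ∈ H, (itemMate y ∈ A ↔ itemId y ∈ A)

open Classical in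
/-- The ends of the matching edges which are kept. -/
noncomputable def settled (m : ℕ) (H : Finset ℕ) : Finset ℕ :=
  if h : ∃ A, IsSettled m H A then h.choose else ∅

/-- The ends of the remaining matching edges, which cover all edges between nodes that are not
settled. -/
noncomputable def coverIds (m : ℕ) (H : Finset ℕ) : Finset ℕ := idsOf H \ settled m H

namespace Params

variable (P : Params)

/-- Nodes are labelled with their colors if a color is much shorter than a message. -/
def UsesColors (H : Finset ℕ) : Prop := P.colored ∧ 2 ^ (P.l + 2) ≤ sizeEstimate H

open Classical in
/-- A strict upper bound for the labels. -/
noncomputable def base (H : Finset ℕ) : ℕ :=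
  -- A label that is not a rank is at most twice a color below `2 ^ l`, or twice an identifier below
  -- n^c ≤ `sizeEstimate H ^ c`. The ranks in the cover are also small enough.
  if P.UsesColors H then 2 ^ (P.l + 2) else 2 * sizeEstimate H ^ P.c + 1

open Classical in
/-- The number of labels in a packet. -/
noncomputable def packetSize (H : Finset ℕ) : ℕ :=
  -- The largest number of digits in base `2 ^ (l + 2)` for which this power of the base does not
  -- exceed `sizeEstimate H`.
  if P.UsesColors H then Nat.log 2 (sizeEstimate H) / (P.l + 2) else 1

open Classical in
/-- The label of a node: `0` for a settled node, an odd number for a node of the cover, and an even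
number for the other nodes. -/
noncomputable def label (H : Finset ℕ) (ident color : ℕ) : ℕ :=
  if ident ∈ settled P.m H then 0
  -- The rank among the cover identifiers, which all nodes know. Cover labels are thus short and
  -- distinct without any luck, and parity separates them from all other labels.
  else if ident ∈ coverIds P.m H then 2 * ((coverIds P.m H).filter (· < ident)).card + 1
  else 2 * (if P.UsesColors H then color else ident) + 2

end Params

/-- The `j`-th block of `p` consecutive entries of a nonempty list, completed by its first entry. -/
def chunk (p : ℕ) (L : List ℕ) (j : ℕ) : List ℕ :=
  -- Padding by an entry of `L` gives every block length exactly `p`, which makes decoding unique,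
  -- and announces nothing false.
  (List.range p).map fun i => L.getD (j * p + i) (L.headD 0)

/-- The packets, of `p` labels each, by which a node with label `a` spreads the list `L` of the
labels of some neighbours. -/
def packets (β p a : ℕ) (L : List ℕ) : Finset ℕ :=
  if L = [] then ∅ else
    (Finset.range (L.length / p + 1)).image fun j => Nat.pair a (Nat.ofDigits β (chunk p L j)) + 1

/-- One of the packets in `Y` tells that a node with label `a` has a neighbour with label `b`. -/
def Carries (β p : ℕ) (Y : Finset ℕ) (a b : ℕ) : Prop :=
  ∃ L : List ℕ, L.length = p ∧ (∀ x ∈ L, x < β) ∧ b ∈ L ∧ Nat.pair a (Nat.ofDigits β L) + 1 ∈ Y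

namespace Params

variable (P : Params)

/-- `F` completes the settled edges to a matching of size `K`, as far as the packets tell. -/
def IsSolution (H Y : Finset ℕ) (F : Finset (ℕ × ℕ)) : Prop :=
  (∀ e ∈ F, Carries (P.base H) (P.packetSize H) Y e.1 e.2 ∧ e.1 ≠ e.2) ∧ ArcDisjoint F ∧
    2 * P.K ≤ (settled P.m H).card + 2 * F.card

open Classical in
/-- A solution, if there is one. -/
noncomputable def solution (H Y : Finset ℕ) : Finset (ℕ × ℕ) :=
  if h : ∃ F, P.IsSolution H Y F then h.choose else ∅

open Classical in
/-- The port which a node chooses, given the solution `F`, its matching port `s`, and the labels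
`inb` of its neighbours. -/
noncomputable def choosePort (H : Finset ℕ) (F : Finset (ℕ × ℕ)) (ident color : ℕ) (s : Option ℕ)
    (inb : ℕ → ℕ) : Option ℕ :=
  if ident ∈ settled P.m H then s
  else if h : ident ∈ coverIds P.m H ∧
      ∃ p, inb p ≠ 0 ∧ (P.label H ident color, inb p) ∈ F then some h.2.choose
  else none

/-- The labels which a node of the cover keeps, given those of its neighbours. -/
noncomputable def keptLabels (H : Finset ℕ) (deg : ℕ) (inb : ℕ → ℕ) : List ℕ :=
  -- Disjoint arcs with tails in the cover use at most twice as many labels as the cover has nodes,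
  -- so this many suffice for the exchange argument.
  (received deg inb).toList.take (2 * (coverIds P.m H).card)

/-- The packets spread by a node, given the labels of its neighbours. -/
noncomputable def ownPackets (H : Finset ℕ) (deg ident color : ℕ) (inb : ℕ → ℕ) : Finset ℕ :=
  if ident ∈ coverIds P.m H then
    packets (P.base H) (P.packetSize H) (P.label H ident color) (P.keptLabels H deg inb)
  else ∅

/-- The number of rounds for spreading the packets. -/
noncomputable def packetRounds (H : Finset ℕ) : ℕ :=
  -- A bound for the number of packets, plus the bound 4K for the distances.
  (coverIds P.m H).card * (2 * (coverIds P.m H).card / P.packetSize H + 1) + 4 * P.K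

open Classical in
/-- The second part of the algorithm, run when all nodes know a small maximal matching `H`. -/
noncomputable def improve (H : Finset ℕ) (color deg ident : ℕ) (s : Option ℕ) : Prog :=
  .step (fun _ => P.label H ident color) fun inb =>
    gossip deg (fun Y =>
      .step (fun p => if P.choosePort H (P.solution H Y) ident color s inb = some p then 1 else 0)
        fun inb' => .done <| if ∃ F, P.IsSolution H Y F then
          .matched {p | P.choosePort H (P.solution H Y) ident color s inb = some p ∨ inb' p ≠ 0}
          else .noSolution)
      (P.packetRounds H) (P.ownPackets H deg ident color inb, ∅)

open Classical in
/-- The items of a node with matching port `s`, where `inb` tells the identifiers of its neighbours,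
and which of these are free. -/
noncomputable def ownItems (deg ident : ℕ) (s : Option ℕ) (inb : ℕ → ℕ) : Finset ℕ :=
  match s with
  | some p => {packItem ident (inb p - 1).unpair.1 deg}
  -- Two adjacent free nodes witness that the matching is not maximal. Thanks to their extra items,
  -- the nodes with items form a vertex cover in every case, so the flooding argument also works
  -- before maximality is known.
  | none => if ∃ p, inb p ≠ 0 ∧ (inb p - 1).unpair.2 = 1 then {packItem ident ident deg} else ∅

/-- The algorithm. -/
noncomputable def program (color deg ident : ℕ) : Prog :=
  greedy ident (fun s =>
    .step (fun _ => Nat.pair ident (if s = none then 1 else 0) + 1) fun inb =>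
      gossip deg (fun H =>
        if 2 * P.K ≤ H.card then .done (.matched {p | s = some p})
        else P.improve H color deg ident s)
        -- 4K rounds for the distance and 2K for the items that are queued before.
        (6 * P.K) (ownItems deg ident s inb, ∅)) P.K none

end Params

/-! ### Packets -/

theorem mem_of_mem_chunk {p j b : ℕ} {L : List ℕ} (hL : L ≠ []) (h : b ∈ chunk p L j) : b ∈ L := by
  obtain ⟨i, _, rfl⟩ := List.mem_map.1 h
  by_cases hi : j * p + i < L.length
  · rw [List.getD_eq_getElem _ _ hi]
    exact List.getElem_mem hi
  · rw [List.getD_eq_default _ _ (not_lt.1 hi)]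
    cases L with
    | nil => exact absurd rfl hL
    | cons x L => simp

theorem length_chunk (p : ℕ) (L : List ℕ) (j : ℕ) : (chunk p L j).length = p := by
  simp [chunk]

theorem card_packets_le (β p a : ℕ) (L : List ℕ) :
    (packets β p a L).card ≤ L.length / p + 1 := by
  unfold packets
  split_ifs
  · simp
  · simpa using Finset.card_image_le (s := Finset.range (L.length / p + 1))

theorem mem_packets {β p a y : ℕ} {L : List ℕ} (h : y ∈ packets β p a L) :
    ∃ j, L ≠ [] ∧ y = Nat.pair a (Nat.ofDigits β (chunk p L j)) + 1 := by
  unfold packets at h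
  split_ifs at h with hL
  · simp at h
  · obtain ⟨j, _, rfl⟩ := Finset.mem_image.1 h
    exact ⟨j, hL, rfl⟩

theorem carries_of_packets {β p a b : ℕ} (hp : 0 < p) {L : List ℕ} (hL : ∀ x ∈ L, x < β)
    (hb : b ∈ L) {Y : Finset ℕ} (hY : packets β p a L ⊆ Y) : Carries β p Y a b := by
  have hne : L ≠ [] := List.ne_nil_of_mem hb
  obtain ⟨i, hi, rfl⟩ := List.mem_iff_getElem.1 hb
  refine ⟨chunk p L (i / p), length_chunk _ _ _, fun x hx => hL x (mem_of_mem_chunk hne hx), ?_,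
    hY ?_⟩
  · refine List.mem_map.2 ⟨i % p, List.mem_range.2 (Nat.mod_lt _ hp), ?_⟩
    rw [Nat.div_add_mod', List.getD_eq_getElem _ _ hi]
  · rw [packets, if_neg hne]
    exact Finset.mem_image.2 ⟨i / p, Finset.mem_range.2
      (Nat.lt_succ_of_le (Nat.div_le_div_right hi.le)), rfl⟩

/-- Packets decode uniquely: `Nat.pair` is injective, and a digit list of known length with entries
below the base is determined by its value. -/
theorem Carries.mem {β p a b : ℕ} (hβ : 1 < β) {Y : Finset ℕ} (h : Carries β p Y a b)
    {R : ℕ → List ℕ → Prop}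
    (hY : ∀ y ∈ Y, ∃ a' L, R a' L ∧ (∀ x ∈ L, x < β) ∧ y ∈ packets β p a' L) :
    ∃ L, R a L ∧ b ∈ L := by
  obtain ⟨L, hlen, hlt, hb, hmem⟩ := h
  obtain ⟨a', L', hR, hL', hpk⟩ := hY _ hmem
  obtain ⟨j, hne, heq⟩ := mem_packets hpk
  obtain ⟨rfl, h2⟩ := Nat.pair_eq_pair.1 (Nat.succ_injective heq)
  have : L = chunk p L' j := Nat.ofDigits_inj_of_len_eq hβ (by rw [hlen, length_chunk]) hlt
    (fun x hx => hL' x (mem_of_mem_chunk hne hx)) h2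
  exact ⟨L', hR, mem_of_mem_chunk hne (this ▸ hb)⟩

theorem lt_of_mem_packets {β p a y A : ℕ} (hβ : 1 < β) {L : List ℕ} (hL : ∀ x ∈ L, x < β)
    (h : y ∈ packets β p a L) (ha : a < A) (hA : β ^ p ≤ A) : y ≤ A ^ 2 := by
  obtain ⟨j, hne, rfl⟩ := mem_packets h
  have h1 : Nat.ofDigits β (chunk p L j) < β ^ p := by
    have := Nat.ofDigits_lt_base_pow_length hβ (l := chunk p L j)
      fun x hx => hL x (mem_of_mem_chunk hne hx)
    rwa [length_chunk] at this
  refine (Nat.pair_lt_max_add_one_sq _ _).trans_le (Nat.pow_le_pow_left ?_ 2)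
  have := h1.trans_le hA
  exact Nat.succ_le_of_lt (max_lt ha this)

/-! ### The items of a matching -/

section Mates

open Classical

variable {V : Type} (N : Network V) (s : V → Option ℕ)

/-- The node to which a matched node is matched. -/
noncomputable def mate (v : V) : V :=
  if h : ∃ w p q, N.Link v p w q ∧ s v = some p then h.choose else v

/-- The item spread by a matched node. -/
noncomputable def matchItem (v : V) : ℕ := packItem (N.id v) (N.id (mate N s v)) (N.deg v)

/-- The items of all matched nodes. -/
noncomputable def matchItems [Fintype V] : Finset ℕ := (matchedNodes s).image (matchItem N s)

variable {N s} {v : V}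

theorem Paired.link_mate (hs : Paired N s) {p : ℕ} (h : s v = some p) :
    ∃ q, N.Link v p (mate N s v) q ∧ s (mate N s v) = some q := by
  obtain ⟨w, q, hl, hw⟩ := hs v p h
  have hex : ∃ w p q, N.Link v p w q ∧ s v = some p := ⟨w, p, q, hl, h⟩
  have hm : mate N s v = hex.choose := dif_pos hex
  obtain ⟨p', q', hl', hp'⟩ := hex.choose_spec
  rw [← hm] at hl'
  obtain rfl : p = p' := Option.some_inj.1 (h.symm.trans hp')
  obtain rfl := hl.node_eq hl'
  exact ⟨q, hl, hw⟩

theorem mem_matchedNodes [Fintype V] : v ∈ matchedNodes s ↔ s v ≠ none := by simp [matchedNodes]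

theorem Paired.link_mate' [Fintype V] (hs : Paired N s) (h : v ∈ matchedNodes s) :
    ∃ p q, N.Link v p (mate N s v) q ∧ s v = some p ∧ s (mate N s v) = some q := by
  obtain ⟨p, hp⟩ := Option.ne_none_iff_exists'.1 (mem_matchedNodes.1 h)
  obtain ⟨q, hl, hq⟩ := hs.link_mate hp
  exact ⟨p, q, hl, hp, hq⟩

theorem Paired.mate_mem [Fintype V] (hs : Paired N s) (h : v ∈ matchedNodes s) :
    mate N s v ∈ matchedNodes s := by
  obtain ⟨p, q, _, _, hq⟩ := hs.link_mate' h
  rw [mem_matchedNodes, hq]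
  simp

theorem Paired.mate_mate [Fintype V] (hs : Paired N s) (h : v ∈ matchedNodes s) :
    mate N s (mate N s v) = v := by
  obtain ⟨p, q, hl, _, hq⟩ := hs.link_mate' h
  obtain ⟨r, hl', _⟩ := hs.link_mate hq
  exact hl'.node_eq hl.symm

theorem Paired.mate_ne [Fintype V] (hs : Paired N s) (h : v ∈ matchedNodes s) :
    mate N s v ≠ v := by
  obtain ⟨p, q, hl, _, _⟩ := hs.link_mate' h
  exact hl.adj.ne'

theorem Saturated.cover [Fintype V] (hs : Saturated N s) (v w : V) (h : N.graph.Adj v w) :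
    v ∈ matchedNodes s ∨ w ∈ matchedNodes s := by
  rw [mem_matchedNodes, mem_matchedNodes]
  by_cases hv : s v = none
  · exact Or.inr (hs v w h hv)
  · exact Or.inl hv

variable (N s) in
/-- The relation of being matched. -/
def IsMate (v w : V) : Prop := ∃ p q, N.Link v p w q ∧ s v = some p

theorem Paired.isMate_symm (hs : Paired N s) (v w : V) (h : IsMate N s v w) : IsMate N s w v := by
  obtain ⟨p, q, hl, hp⟩ := h
  obtain ⟨w', q', hl', hq'⟩ := hs v p hp
  obtain rfl := hl.node_eq hl'
  exact ⟨q', p, hl'.symm, hq'⟩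

variable (N s) in
theorem isMate_adj (v w : V) (h : IsMate N s v w) : N.graph.Adj v w := by
  obtain ⟨p, q, hl, _⟩ := h
  exact hl.adj

variable (N s) in
theorem isMate_unique (v w w' : V) (h : IsMate N s v w) (h' : IsMate N s v w') : w = w' := by
  obtain ⟨p, q, hl, hp⟩ := h
  obtain ⟨p', q', hl', hp'⟩ := h'
  obtain rfl : p = p' := Option.some_inj.1 (hp.symm.trans hp')
  exact hl.node_eq hl'

theorem Paired.exists_isMate [Fintype V] (hs : Paired N s) :
    {v | ∃ w, IsMate N s v w} = (matchedNodes s : Set V) := by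
  ext v
  rw [Finset.mem_coe, mem_matchedNodes, Set.mem_ofPred_eq]
  constructor
  · rintro ⟨w, p, q, _, hp⟩
    rw [hp]; simp
  · intro h
    obtain ⟨p, hp⟩ := Option.ne_none_iff_exists'.1 h
    obtain ⟨q, hl, _⟩ := hs.link_mate hp
    exact ⟨_, p, q, hl, hp⟩

theorem Paired.exists_matching [Fintype V] (hs : Paired N s) :
    ∃ M : N.graph.Subgraph, M.IsMatching ∧ 2 * M.edgeSet.ncard = (matchedNodes s).card ∧
      ∀ v w, M.Adj v w ↔ IsMate N s v w := by
  refine ⟨matchingOf (IsMate N s) (isMate_adj N s) hs.isMate_symm,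
    isMatching_matchingOf _ _ (isMate_unique N s), ?_, fun _ _ => Iff.rfl⟩
  rw [two_mul_ncard_edgeSet (isMatching_matchingOf _ _ (isMate_unique N s))]
  change Set.ncard {v | ∃ w, IsMate N s v w} = _
  rw [hs.exists_isMate, Set.ncard_coe_finset]

variable (N s) in
theorem matchItem_injective : Function.Injective (matchItem N s) := by
  intro v w h
  have := congrArg itemId h
  exact N.id_injective (by simpa [matchItem] using this)

variable [Fintype V]

variable (N s) in
theorem card_matchItems : (matchItems N s).card = (matchedNodes s).card :=
  Finset.card_image_of_injective _ (matchItem_injective N s)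

variable (N s) in
theorem idsOf_matchItems : idsOf (matchItems N s) = (matchedNodes s).image N.id := by
  rw [idsOf, matchItems, Finset.image_image]
  congr 1
  funext v
  simp [matchItem]

theorem mem_idsOf_matchItems : N.id v ∈ idsOf (matchItems N s) ↔ v ∈ matchedNodes s := by
  rw [idsOf_matchItems, Finset.mem_image]
  exact ⟨fun ⟨w, hw, h⟩ => N.id_injective h ▸ hw, fun h => ⟨v, h, rfl⟩⟩

/-- The default value in `settled` does not occur: mates form a fixed-point-free involution, so a
union of the required number of matched pairs exists. -/
theorem isSettled_settled (hs : Paired N s) (m : ℕ) :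
    IsSettled m (matchItems N s) (settled m (matchItems N s)) := by
  have hex : ∃ A, IsSettled m (matchItems N s) A := by
    obtain ⟨M, hM, hcard, _⟩ := hs.exists_matching
    obtain ⟨A, hA, hAcard, hinv⟩ := exists_invariant_subset (fun a ha => hs.mate_mem ha)
      (fun a ha => hs.mate_mate ha) (fun a ha => hs.mate_ne ha) (min m M.edgeSet.ncard) (by omega)
    refine ⟨A.image N.id, ?_, ?_, ?_⟩
    · rw [idsOf_matchItems]
      exact Finset.image_subset_image hA
    · rw [Finset.card_image_of_injective _ N.id_injective, hAcard, card_matchItems]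
      omega
    · intro y hy
      obtain ⟨v, hv, rfl⟩ := Finset.mem_image.1 hy
      have := hinv v hv
      simpa [matchItem, N.id_injective.eq_iff] using this
  rw [settled, dif_pos hex]
  exact hex.choose_spec

variable (N s) in
/-- The settled nodes. -/
noncomputable def settledNodes (m : ℕ) : Finset V :=
  Finset.univ.filter fun v => N.id v ∈ settled m (matchItems N s)

variable (N s) in
/-- The nodes of the cover. -/
noncomputable def coverNodes (m : ℕ) : Finset V :=
  Finset.univ.filter fun v => N.id v ∈ coverIds m (matchItems N s)

variable {m : ℕ}

theorem mem_settledNodes : v ∈ settledNodes N s m ↔ N.id v ∈ settled m (matchItems N s) := by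
  simp [settledNodes]

theorem mem_coverNodes : v ∈ coverNodes N s m ↔ N.id v ∈ coverIds m (matchItems N s) := by
  simp [coverNodes]

theorem mem_coverNodes' :
    v ∈ coverNodes N s m ↔ v ∈ matchedNodes s ∧ v ∉ settledNodes N s m := by
  rw [mem_coverNodes, coverIds, Finset.mem_sdiff, mem_idsOf_matchItems, mem_settledNodes]

theorem settledNodes_subset (hs : Paired N s) : settledNodes N s m ⊆ matchedNodes s := fun _ hv =>
  mem_idsOf_matchItems.1 ((isSettled_settled hs m).1 (mem_settledNodes.1 hv))

theorem card_settled (hs : Paired N s) :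
    (settled m (matchItems N s)).card = min (2 * m) (matchedNodes s).card := by
  rw [(isSettled_settled hs m).2.1, card_matchItems]

theorem card_settledNodes (hs : Paired N s) :
    (settledNodes N s m).card = (settled m (matchItems N s)).card := by
  rw [← Finset.card_image_of_injective _ N.id_injective]
  congr 1
  ext i
  refine ⟨fun h => ?_, fun h => ?_⟩
  · obtain ⟨v, hv, rfl⟩ := Finset.mem_image.1 h
    exact mem_settledNodes.1 hv
  · have h' := (isSettled_settled hs m).1 h
    rw [idsOf_matchItems] at h'
    obtain ⟨v, _, rfl⟩ := Finset.mem_image.1 h'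
    exact Finset.mem_image.2 ⟨v, mem_settledNodes.2 h, rfl⟩

theorem mate_mem_settledNodes (hs : Paired N s) (hv : v ∈ settledNodes N s m) :
    mate N s v ∈ settledNodes N s m := by
  have := (isSettled_settled hs m).2.2 (matchItem N s v)
    (Finset.mem_image.2 ⟨v, settledNodes_subset hs hv, rfl⟩)
  rw [matchItem, itemMate_packItem, itemId_packItem] at this
  exact mem_settledNodes.2 (this.2 (mem_settledNodes.1 hv))

variable (N s m) in
theorem coverIds_eq : coverIds m (matchItems N s) = (coverNodes N s m).image N.id := by
  ext i
  refine ⟨fun h => ?_, fun h => ?_⟩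
  · have h' := (Finset.mem_sdiff.1 h).1
    rw [idsOf_matchItems] at h'
    obtain ⟨v, _, rfl⟩ := Finset.mem_image.1 h'
    exact Finset.mem_image.2 ⟨v, mem_coverNodes.2 h, rfl⟩
  · obtain ⟨v, hv, rfl⟩ := Finset.mem_image.1 h
    exact mem_coverNodes.1 hv

variable (N s m) in
theorem card_coverIds : (coverIds m (matchItems N s)).card = (coverNodes N s m).card := by
  rw [coverIds_eq, Finset.card_image_of_injective _ N.id_injective]

theorem card_coverNodes (hs : Paired N s) :
    (coverNodes N s m).card = (matchedNodes s).card - min (2 * m) (matchedNodes s).card := by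
  have : coverNodes N s m = matchedNodes s \ settledNodes N s m := by
    ext v; rw [mem_coverNodes', Finset.mem_sdiff]
  rw [this, Finset.card_sdiff_of_subset (settledNodes_subset hs), card_settledNodes hs,
    card_settled hs]

variable (N s) in
theorem sizeEstimate_eq :
    sizeEstimate (matchItems N s) = ∑ v ∈ matchedNodes s, (N.deg v + 1) := by
  rw [sizeEstimate, matchItems, Finset.sum_image fun v _ w _ h => matchItem_injective N s h]
  simp [matchItem]

variable (N s) in
theorem sizeEstimate_le : sizeEstimate (matchItems N s) ≤ Fintype.card V ^ 2 := by
  rw [sizeEstimate_eq, sq]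
  have h1 : ∀ v ∈ matchedNodes s, N.deg v + 1 ≤ Fintype.card V := fun v _ =>
    Network.deg_lt_card v
  refine (Finset.sum_le_card_nsmul _ _ _ h1).trans ?_
  rw [smul_eq_mul]
  exact Nat.mul_le_mul_right _ (Finset.card_le_univ _)

/-- By maximality the closed neighbourhoods of the matched nodes cover the network. A single node
would be unmatched and give the estimate 0. -/
theorem card_le_sizeEstimate (hsat : Saturated N s) (hconn : N.graph.Connected)
    (hn : 1 < Fintype.card V) : Fintype.card V ≤ sizeEstimate (matchItems N s) := by
  have hcov : (Finset.univ : Finset V) ⊆ (matchedNodes s).biUnion fun v =>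
      insert v (Finset.univ.image (N.nbr v)) := by
    intro v _
    rw [Finset.mem_biUnion]
    by_cases hv : v ∈ matchedNodes s
    · exact ⟨v, hv, Finset.mem_insert_self _ _⟩
    · have : Nontrivial V := Fintype.one_lt_card_iff_nontrivial.1 hn
      obtain ⟨w, hw⟩ := hconn.preconnected.exists_adj_of_nontrivial v
      have hwm := (hsat.cover v w hw).resolve_left hv
      obtain ⟨p, q, hl⟩ := Network.exists_link_of_adj hw.symm
      refine ⟨w, hwm, Finset.mem_insert_of_mem (Finset.mem_image.2 ⟨⟨p, hl.lt⟩, Finset.mem_univ _, ?_⟩)⟩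
      obtain ⟨_, _, h, _⟩ := hl
      exact h
  have := (Finset.card_le_card hcov).trans Finset.card_biUnion_le
  rw [Finset.card_univ] at this
  rw [sizeEstimate_eq]
  refine this.trans (Finset.sum_le_sum fun v _ => ?_)
  refine (Finset.card_insert_le _ _).trans (Nat.succ_le_succ ?_)
  simpa using Finset.card_image_le (s := (Finset.univ : Finset (Fin (N.deg v)))) (f := N.nbr v)

end Mates

theorem packetSize_pos (P : Params) (H : Finset ℕ) : 0 < P.packetSize H := by
  rw [Params.packetSize]
  split_ifs with hcol
  · refine Nat.div_pos ?_ (by omega)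
    exact Nat.le_log_of_pow_le one_lt_two hcol.2
  · exact one_pos

theorem base_pow_packetSize_le (P : Params) {H : Finset ℕ} (hH : H.Nonempty) :
    P.base H ^ P.packetSize H ≤ 3 * sizeEstimate H ^ (P.c + 1) := by
  have hpos : 0 < sizeEstimate H := Finset.sum_pos (fun _ _ => Nat.succ_pos _) hH
  have h1 : sizeEstimate H ≤ sizeEstimate H ^ (P.c + 1) := Nat.le_self_pow (by omega) _
  have h2 : sizeEstimate H ^ P.c ≤ sizeEstimate H ^ (P.c + 1) :=
    Nat.pow_le_pow_right hpos (by omega)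
  have h3 : 0 < sizeEstimate H ^ P.c := Nat.pow_pos hpos
  rw [Params.base, Params.packetSize]
  split_ifs with hcol
  · rw [← pow_mul]
    have : 2 ^ ((P.l + 2) * (Nat.log 2 (sizeEstimate H) / (P.l + 2))) ≤ sizeEstimate H :=
      (Nat.pow_le_pow_right two_pos (Nat.mul_div_le _ _)).trans (Nat.pow_log_le_self 2 hpos.ne')
    omega
  · rw [pow_one]
    omega

theorem mem_received {V : Type} {N : Network V} {v : V} {g : V → ℕ → ℕ} (hg : ∀ v i j, g v i = g v j) {y : ℕ} :
    y ∈ received (N.deg v) (N.deliver g v) ↔ y ≠ 0 ∧ ∃ w, N.graph.Adj v w ∧ g w 0 = y := by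
  rw [received, Finset.mem_erase]
  refine and_congr_right fun _ => ⟨fun h => ?_, fun ⟨w, hw, h⟩ => ?_⟩
  · obtain ⟨p, hp, rfl⟩ := Finset.mem_image.1 h
    obtain ⟨w, q, hl⟩ := Network.exists_link_of_lt (N := N) (Finset.mem_range.1 hp)
    exact ⟨w, hl.adj, by rw [hl.deliver, hg w 0 q]⟩
  · obtain ⟨p, q, hl⟩ := Network.exists_link_of_adj hw
    exact Finset.mem_image.2 ⟨p, Finset.mem_range.2 hl.lt, by rw [hl.deliver, hg w q 0, h]⟩


/-! ### Improving a small maximal matching -/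

section Improve

open Classical

variable {V : Type} [Fintype V]

/-- The assumptions for the second part of the algorithm. -/
structure Valid (N : Network V) (P : Params) (s : V → Option ℕ) (color : V → ℕ) : Prop where
  paired : Paired N s
  saturated : Saturated N s
  connected : N.graph.Connected
  c_pos : 1 ≤ P.c
  id_lt : ∀ v, N.id v < Fintype.card V ^ P.c
  color_lt : ∀ v, color v < 2 ^ P.l
  cover_le : P.colored → (coverNodes N s P.m).card ≤ 2 ^ P.l

variable (N : Network V) (P : Params) (s : V → Option ℕ) (color : V → ℕ)

/-- The labels of the nodes. -/
noncomputable def nodeLabel (v : V) (_ : ℕ) : ℕ := P.label (matchItems N s) (N.id v) (color v)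

/-- The labels of its neighbours which a node keeps. -/
noncomputable def nodeKept (v : V) : List ℕ :=
  P.keptLabels (matchItems N s) (N.deg v) (N.deliver (nodeLabel N P s color) v)

/-- The packets of a node. -/
noncomputable def nodePackets (v : V) : Finset ℕ :=
  P.ownPackets (matchItems N s) (N.deg v) (N.id v) (color v) (N.deliver (nodeLabel N P s color) v)

/-- The port chosen by a node. -/
noncomputable def nodePort (v : V) : Option ℕ :=
  P.choosePort (matchItems N s) (P.solution (matchItems N s) (allItems (nodePackets N P s color)))
    (N.id v) (color v) (s v) (N.deliver (nodeLabel N P s color) v)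

/-- The notifications sent through the chosen ports. -/
noncomputable def nodeNotify (v : V) (p : ℕ) : ℕ := if nodePort N P s color v = some p then 1 else 0

/-- The final answers. -/
noncomputable def nodeAnswer (v : V) : Answer :=
  if ∃ F, P.IsSolution (matchItems N s) (allItems (nodePackets N P s color)) F then
    .matched {p | nodePort N P s color v = some p ∨ N.deliver (nodeNotify N P s color) v p ≠ 0}
  else .noSolution

variable {N P s color} {v w : V}

/-! #### Labels -/

theorem nodeLabel_of_settled (hv : v ∈ settledNodes N s P.m) (i : ℕ) :
    nodeLabel N P s color v i = 0 := if_pos (mem_settledNodes.1 hv)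

theorem nodeLabel_of_cover (hv : v ∈ coverNodes N s P.m) (i : ℕ) :
    nodeLabel N P s color v i =
      2 * ((coverIds P.m (matchItems N s)).filter (· < N.id v)).card + 1 := by
  have h := (mem_coverNodes'.1 hv).2
  rw [mem_settledNodes] at h
  rw [nodeLabel, Params.label, if_neg h, if_pos (mem_coverNodes.1 hv)]

theorem nodeLabel_of_other (hv : v ∉ settledNodes N s P.m) (hv' : v ∉ coverNodes N s P.m) (i : ℕ) :
    nodeLabel N P s color v i =
      2 * (if P.UsesColors (matchItems N s) then color v else N.id v) + 2 := by
  rw [mem_settledNodes] at hv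
  rw [mem_coverNodes] at hv'
  rw [nodeLabel, Params.label, if_neg hv, if_neg hv']

theorem nodeLabel_ne_zero {i : ℕ} :
    nodeLabel N P s color v i ≠ 0 ↔ v ∉ settledNodes N s P.m := by
  by_cases h : v ∈ settledNodes N s P.m
  · simp [nodeLabel_of_settled h, h]
  · by_cases h' : v ∈ coverNodes N s P.m
    · simp [nodeLabel_of_cover h', h]
    · simp [nodeLabel_of_other h h', h]

theorem rank_lt (hv : v ∈ coverNodes N s P.m) :
    ((coverIds P.m (matchItems N s)).filter (· < N.id v)).card < (coverNodes N s P.m).card := by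
  rw [← card_coverIds]
  refine Finset.card_lt_card (Finset.filter_ssubset.2 ⟨N.id v, mem_coverNodes.1 hv, lt_irrefl _⟩)

theorem nodeLabel_injOn {i j : ℕ} (hv : v ∈ coverNodes N s P.m) (hw : w ∈ coverNodes N s P.m)
    (h : nodeLabel N P s color v i = nodeLabel N P s color w j) : v = w := by
  rw [nodeLabel_of_cover hv, nodeLabel_of_cover hw] at h
  have key : ∀ {a b : V}, a ∈ coverNodes N s P.m → N.id a < N.id b →
      ((coverIds P.m (matchItems N s)).filter (· < N.id a)).card <
        ((coverIds P.m (matchItems N s)).filter (· < N.id b)).card := by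
    intro a b ha hab
    refine Finset.card_lt_card (Finset.ssubset_iff_of_subset ?_ |>.2 ⟨N.id a, ?_, ?_⟩)
    · intro x hx
      rw [Finset.mem_filter] at hx ⊢
      exact ⟨hx.1, hx.2.trans hab⟩
    · exact Finset.mem_filter.2 ⟨mem_coverNodes.1 ha, hab⟩
    · simp
  rcases lt_trichotomy (N.id v) (N.id w) with hlt | heq | hlt
  · have := key hv hlt; omega
  · exact N.id_injective heq
  · have := key hw hlt; omega

theorem Valid.one_lt_card (hn : N.graph.Adj v w) : 1 < Fintype.card V :=
  Fintype.one_lt_card_iff.2 ⟨v, w, hn.ne⟩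

theorem Valid.one_lt_card_of_cover (h : Valid N P s color) (hv : v ∈ coverNodes N s P.m) :
    1 < Fintype.card V := by
  obtain ⟨p, q, hl, _⟩ := h.paired.link_mate' (mem_coverNodes'.1 hv).1
  exact Valid.one_lt_card hl.adj

theorem Valid.card_le (h : Valid N P s color) (hn : 1 < Fintype.card V) :
    Fintype.card V ≤ sizeEstimate (matchItems N s) :=
  card_le_sizeEstimate h.saturated h.connected hn

theorem Valid.nodeLabel_lt_base (h : Valid N P s color) (hn : 1 < Fintype.card V) (v : V) (i : ℕ) :
    nodeLabel N P s color v i < P.base (matchItems N s) := by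
  have hcard := h.card_le hn
  have hS : sizeEstimate (matchItems N s) ≤ sizeEstimate (matchItems N s) ^ P.c :=
    Nat.le_self_pow (by have := h.c_pos; omega) _
  have hcov := (coverNodes N s P.m).card_le_univ
  by_cases hv : v ∈ settledNodes N s P.m
  · rw [nodeLabel_of_settled hv, Params.base]
    split_ifs <;> positivity
  by_cases hv' : v ∈ coverNodes N s P.m
  · have := rank_lt hv'
    rw [nodeLabel_of_cover hv', Params.base]
    split_ifs with hcol
    · have := h.cover_le hcol.1
      rw [pow_add]
      omega
    · omega
  · rw [nodeLabel_of_other hv hv', Params.base]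
    split_ifs with hcol
    · have := h.color_lt v
      rw [pow_add]
      omega
    · have := (h.id_lt v).trans_le (Nat.pow_le_pow_left hcard P.c)
      omega

theorem Valid.one_lt_base (h : Valid N P s color) (hn : 1 < Fintype.card V) :
    1 < P.base (matchItems N s) := by
  have hcard := h.card_le hn
  rw [Params.base]
  split_ifs with hcol
  · exact Nat.one_lt_two_pow (by omega)
  · have : 0 < sizeEstimate (matchItems N s) ^ P.c := Nat.pow_pos (by omega)
    omega

/-! #### Packets -/

theorem mem_received_nodeLabel {y : ℕ} :
    y ∈ received (N.deg v) (N.deliver (nodeLabel N P s color) v) ↔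
      y ≠ 0 ∧ ∃ w, N.graph.Adj v w ∧ nodeLabel N P s color w 0 = y :=
  mem_received fun _ _ _ => rfl

theorem of_mem_nodeKept {y : ℕ} (h : y ∈ nodeKept N P s color v) :
    y ≠ 0 ∧ ∃ w, N.graph.Adj v w ∧ nodeLabel N P s color w 0 = y :=
  mem_received_nodeLabel.1 (Finset.mem_toList.1 (List.mem_of_mem_take h))

variable (N P s color) in
theorem length_nodeKept_le (v : V) :
    (nodeKept N P s color v).length ≤ 2 * (coverNodes N s P.m).card := by
  rw [nodeKept, Params.keptLabels, card_coverIds]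
  exact List.length_take_le _ _

/-- A node of the cover keeps all labels of its neighbours, or many. -/
theorem mem_nodeKept_or (hvw : N.graph.Adj v w) (hw : nodeLabel N P s color w 0 ≠ 0) :
    nodeLabel N P s color w 0 ∈ nodeKept N P s color v ∨
      2 * (coverNodes N s P.m).card ≤ (nodeKept N P s color v).toFinset.card := by
  have hmem := mem_received_nodeLabel.2 ⟨hw, w, hvw, rfl⟩
  rw [nodeKept, Params.keptLabels, card_coverIds]
  set A := received (N.deg v) (N.deliver (nodeLabel N P s color) v)
  by_cases h : 2 * (coverNodes N s P.m).card ≤ A.toList.length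
  · right
    rw [List.toFinset_card_of_nodup ((List.take_sublist _ _).nodup A.nodup_toList),
      List.length_take]
    omega
  · left
    rw [List.take_of_length_le (by omega)]
    exact Finset.mem_toList.2 hmem

theorem nodePackets_of_cover (hv : v ∈ coverNodes N s P.m) : nodePackets N P s color v =
    packets (P.base (matchItems N s)) (P.packetSize (matchItems N s))
      (nodeLabel N P s color v 0) (nodeKept N P s color v) := if_pos (mem_coverNodes.1 hv)

theorem nodePackets_of_not_cover (hv : v ∉ coverNodes N s P.m) : nodePackets N P s color v = ∅ :=
  if_neg fun h => hv (mem_coverNodes.2 h)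

theorem of_mem_nodePackets {y : ℕ} (h : y ∈ nodePackets N P s color v) :
    v ∈ coverNodes N s P.m ∧ y ∈ packets (P.base (matchItems N s)) (P.packetSize (matchItems N s))
      (nodeLabel N P s color v 0) (nodeKept N P s color v) := by
  by_cases hv : v ∈ coverNodes N s P.m
  · exact ⟨hv, nodePackets_of_cover hv ▸ h⟩
  · rw [nodePackets_of_not_cover hv] at h
    exact absurd h (Finset.notMem_empty _)

theorem Valid.nodeKept_lt (h : Valid N P s color) {y : ℕ} (hy : y ∈ nodeKept N P s color v) :
    y < P.base (matchItems N s) := by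
  obtain ⟨_, w, hw, rfl⟩ := of_mem_nodeKept hy
  exact h.nodeLabel_lt_base (Valid.one_lt_card hw) w 0

/-- The flooded packets convey exactly the kept neighbour labels of the cover nodes; no spurious
adjacency can be decoded. -/
theorem Valid.carries_iff (h : Valid N P s color) {a b : ℕ} :
    Carries (P.base (matchItems N s)) (P.packetSize (matchItems N s))
      (allItems (nodePackets N P s color)) a b ↔
    ∃ v ∈ coverNodes N s P.m, nodeLabel N P s color v 0 = a ∧ b ∈ nodeKept N P s color v := by
  constructor
  · intro hc
    have hbase : 1 < P.base (matchItems N s) := by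
      obtain ⟨_, _, _, _, hmem⟩ := hc
      obtain ⟨v, _, hv⟩ := Finset.mem_biUnion.1 hmem
      exact h.one_lt_base (h.one_lt_card_of_cover (of_mem_nodePackets hv).1)
    obtain ⟨L, ⟨v, hv, h1, rfl⟩, hb⟩ := hc.mem hbase (R := fun a L =>
      ∃ v ∈ coverNodes N s P.m, nodeLabel N P s color v 0 = a ∧ L = nodeKept N P s color v) (by
        intro y hy
        obtain ⟨v, _, hv⟩ := Finset.mem_biUnion.1 hy
        obtain ⟨hvC, hv⟩ := of_mem_nodePackets hv
        exact ⟨_, _, ⟨v, hvC, rfl, rfl⟩, fun x hx => h.nodeKept_lt hx, hv⟩)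
    exact ⟨v, hv, h1, hb⟩
  · rintro ⟨v, hv, rfl, hb⟩
    refine carries_of_packets (packetSize_pos _ _) (fun x hx => h.nodeKept_lt hx) hb ?_
    rw [← nodePackets_of_cover hv]
    exact fun y hy => Finset.mem_biUnion.2 ⟨v, Finset.mem_univ v, hy⟩

variable (N P s color) in
theorem card_allItems_nodePackets_le : (allItems (nodePackets N P s color)).card ≤
    (coverNodes N s P.m).card *
      (2 * (coverNodes N s P.m).card / P.packetSize (matchItems N s) + 1) := by
  have hsub : allItems (nodePackets N P s color) ⊆
      (coverNodes N s P.m).biUnion (nodePackets N P s color) := by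
    intro y hy
    obtain ⟨v, _, hv⟩ := Finset.mem_biUnion.1 hy
    exact Finset.mem_biUnion.2 ⟨v, (of_mem_nodePackets hv).1, hv⟩
  refine (Finset.card_le_card hsub).trans (Finset.card_biUnion_le_card_mul _ _ _ fun v hv => ?_)
  rw [nodePackets_of_cover hv]
  refine (card_packets_le _ _ _ _).trans (Nat.succ_le_succ (Nat.div_le_div_right ?_))
  exact length_nodeKept_le N P s color v

end Improve

/-! ### Correctness of the improvement step -/

section Correctness

open Classical

variable {V : Type}

/-- The answers describe a matching of size at least `K`, or all nodes report, and rightly so, that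
there is no matching of size `k`. -/
def Outcome (N : Network V) (K k : ℕ) (out : V → Answer) : Prop :=
  (∃ M : N.graph.Subgraph, M.IsMatching ∧ K ≤ M.edgeSet.ncard ∧
      ∀ v : V, ∃ S : Set ℕ, out v = Answer.matched S ∧
        ∀ p : Fin (N.deg v), (p : ℕ) ∈ S ↔ M.Adj v (N.nbr v p)) ∨
    ((∀ v : V, out v = Answer.noSolution) ∧ ¬ HasMatching N.graph k)

variable [Fintype V]

variable (N : Network V) (P : Params) (s : V → Option ℕ) (color : V → ℕ)

/-- Node `v` chooses the edge to node `w`. -/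
def Chooses (v w : V) : Prop := ∃ p q, N.Link v p w q ∧ nodePort N P s color v = some p

/-- The solution found by all nodes. -/
noncomputable def nodeSolution : Finset (ℕ × ℕ) :=
  P.solution (matchItems N s) (allItems (nodePackets N P s color))

/-- There is a solution. -/
def Solvable : Prop :=
  ∃ F, P.IsSolution (matchItems N s) (allItems (nodePackets N P s color)) F

variable {N P s color} {v w : V}

theorem Solvable.isSolution (h : Solvable N P s color) : P.IsSolution (matchItems N s)
    (allItems (nodePackets N P s color)) (nodeSolution N P s color) := by
  rw [nodeSolution, Params.solution, dif_pos (show ∃ F, _ from h)]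
  exact h.choose_spec

theorem nodePort_of_settled (hv : v ∈ settledNodes N s P.m) : nodePort N P s color v = s v :=
  if_pos (mem_settledNodes.1 hv)

/-- Ports are chosen by label only. When colors collide, any neighbour with the right label will do.
-/
theorem nodePort_spec (hv : v ∉ settledNodes N s P.m) {p : ℕ}
    (hp : nodePort N P s color v = some p) : v ∈ coverNodes N s P.m ∧
      ∃ w q, N.Link v p w q ∧ w ∉ settledNodes N s P.m ∧
        (nodeLabel N P s color v 0, nodeLabel N P s color w 0) ∈ nodeSolution N P s color := by
  rw [mem_settledNodes] at hv
  rw [nodePort, Params.choosePort, if_neg hv] at hp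
  split_ifs at hp with hex
  have hspec := hex.2.choose_spec
  rw [Option.some_inj.1 hp] at hspec
  refine ⟨mem_coverNodes.2 hex.1, ?_⟩
  obtain ⟨w, q, hl, heq⟩ := Network.deliver_ne_zero hspec.1
  rw [heq] at hspec
  exact ⟨w, q, hl, nodeLabel_ne_zero.1 hspec.1, hspec.2⟩

theorem exists_nodePort (hv : v ∈ coverNodes N s P.m) (hvw : N.graph.Adj v w)
    (hw : nodeLabel N P s color w 0 ≠ 0)
    (hF : (nodeLabel N P s color v 0, nodeLabel N P s color w 0) ∈ nodeSolution N P s color) :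
    ∃ p, nodePort N P s color v = some p := by
  obtain ⟨p, q, hl⟩ := Network.exists_link_of_adj hvw
  have hns := (mem_coverNodes'.1 hv).2
  rw [mem_settledNodes] at hns
  have hdel : N.deliver (nodeLabel N P s color) v p = nodeLabel N P s color w 0 := hl.deliver _
  rw [nodePort, Params.choosePort, if_neg hns, dif_pos ⟨mem_coverNodes.1 hv, p, by rwa [hdel], by rwa [hdel]⟩]
  exact ⟨_, rfl⟩

theorem Chooses.cases (hs : Paired N s) (h : Chooses N P s color v w) :
    (v ∈ settledNodes N s P.m ∧ w ∈ settledNodes N s P.m ∧ IsMate N s v w) ∨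
    (v ∈ coverNodes N s P.m ∧ v ∉ settledNodes N s P.m ∧ w ∉ settledNodes N s P.m ∧
      (nodeLabel N P s color v 0, nodeLabel N P s color w 0) ∈ nodeSolution N P s color) := by
  obtain ⟨p, q, hl, hp⟩ := h
  by_cases hv : v ∈ settledNodes N s P.m
  · left
    rw [nodePort_of_settled hv] at hp
    obtain ⟨q', hl', _⟩ := hs.link_mate hp
    obtain rfl := hl.node_eq hl'
    exact ⟨hv, mate_mem_settledNodes hs hv, p, q, hl, hp⟩
  · right
    obtain ⟨hC, w', q', hl', hw, hF⟩ := nodePort_spec hv hp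
    obtain rfl := hl.node_eq hl'
    exact ⟨hC, hv, hw, hF⟩

theorem Chooses.unique {w' : V} (h : Chooses N P s color v w) (h' : Chooses N P s color v w') :
    w = w' := by
  obtain ⟨p, q, hl, hp⟩ := h
  obtain ⟨p', q', hl', hp'⟩ := h'
  obtain rfl : p = p' := Option.some_inj.1 (hp.symm.trans hp')
  exact hl.node_eq hl'

variable (N P s color) in
/-- One of the nodes `v` and `w` chooses the edge between them. -/
def Joined (v w : V) : Prop := Chooses N P s color v w ∨ Chooses N P s color w v

theorem Joined.isMate (hs : Paired N s) (hv : v ∈ settledNodes N s P.m)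
    (h : Joined N P s color v w) : IsMate N s v w := by
  rcases h with h | h
  · exact ((h.cases hs).resolve_right fun h => h.2.1 hv).2.2
  · exact hs.isMate_symm _ _ ((h.cases hs).resolve_right fun h => h.2.2.1 hv).2.2

/-- Two edges chosen at an unsettled node give arcs of labels sharing an end, hence the same arc. It
is no loop, so the node cannot be both tail and head; and two choosers with the same label coincide,
as cover labels are distinct. -/
theorem Joined.unique (hs : Paired N s) (hsol : Solvable N P s color) {w' : V}
    (h : Joined N P s color v w) (h' : Joined N P s color v w') : w = w' := by
  by_cases hv : v ∈ settledNodes N s P.m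
  · exact isMate_unique N s _ _ _ (h.isMate hs hv) (h'.isMate hs hv)
  obtain ⟨hF1, hF2, -⟩ := hsol.isSolution
  have hin : ∀ {w w' : V}, Chooses N P s color v w → Chooses N P s color w' v → False := by
    intro w w' h h'
    obtain ⟨-, -, -, he⟩ := (h.cases hs).resolve_left fun h => hv h.1
    obtain ⟨-, -, -, he'⟩ := (h'.cases hs).resolve_left fun h => hv h.2.1
    by_cases hne : (nodeLabel N P s color v 0, nodeLabel N P s color w 0)
        = (nodeLabel N P s color w' 0, nodeLabel N P s color v 0)
    · exact (hF1 _ he).2 (Prod.ext_iff.1 hne).2.symm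
    · exact (hF2 _ he _ he' hne).2.1 rfl
  rcases h with h | h <;> rcases h' with h' | h'
  · exact h.unique h'
  · exact (hin h h').elim
  · exact (hin h' h).elim
  · obtain ⟨hC, -, -, he⟩ := (h.cases hs).resolve_left fun h => hv h.2.1
    obtain ⟨hC', -, -, he'⟩ := (h'.cases hs).resolve_left fun h => hv h.2.1
    refine nodeLabel_injOn (P := P) (color := color) (i := 0) (j := 0) hC hC' ?_
    by_contra hne
    exact (hF2 _ he _ he' fun h => hne (Prod.ext_iff.1 h).1).2.2.2 rfl

theorem Joined.symm (h : Joined N P s color v w) : Joined N P s color w v := Or.symm h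

theorem Joined.adj (h : Joined N P s color v w) : N.graph.Adj v w := by
  rcases h with ⟨p, q, hl, _⟩ | ⟨p, q, hl, _⟩
  · exact hl.adj
  · exact hl.adj.symm

/-- Labels are counted instead of nodes: the 2|F| ends of the arcs are distinct labels, and each is
the label of some joined unsettled node. The settled nodes, all joined, come in addition. -/
theorem Valid.card_joined (h : Valid N P s color) (hsol : Solvable N P s color) :
    2 * P.K ≤ (Finset.univ.filter fun v => ∃ w, Joined N P s color v w).card := by
  obtain ⟨hF1, hF2, hF3⟩ := hsol.isSolution
  set F := nodeSolution N P s color with hF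
  set X := Finset.univ.filter fun v => ∃ w, Joined N P s color v w with hX
  have hset : settledNodes N s P.m ⊆ X := by
    intro v hv
    obtain ⟨p, hp⟩ := Option.ne_none_iff_exists'.1
      (mem_matchedNodes.1 (settledNodes_subset h.paired hv))
    obtain ⟨q, hl, _⟩ := h.paired.link_mate hp
    exact Finset.mem_filter.2 ⟨Finset.mem_univ _, _, Or.inl
      ⟨p, q, hl, (nodePort_of_settled hv).trans hp⟩⟩
  have hends : F.image Prod.fst ∪ F.image Prod.snd ⊆
      (X \ settledNodes N s P.m).image fun v => nodeLabel N P s color v 0 := by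
    have key : ∀ e ∈ F, ∃ v ∈ X \ settledNodes N s P.m, ∃ w ∈ X \ settledNodes N s P.m,
        nodeLabel N P s color v 0 = e.1 ∧ nodeLabel N P s color w 0 = e.2 := by
      intro e he
      obtain ⟨v, hv, h1, h2⟩ := h.carries_iff.1 (hF1 e he).1
      obtain ⟨hne, w, hvw, hw⟩ := of_mem_nodeKept h2
      obtain ⟨p, hp⟩ := exists_nodePort hv hvw (hw ▸ hne) (by rw [h1, hw]; exact he)
      have hvS := (mem_coverNodes'.1 hv).2
      obtain ⟨_, w', q, hl, hw'S, hmem⟩ := nodePort_spec hvS hp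
      have hch : Chooses N P s color v w' := ⟨p, q, hl, hp⟩
      refine ⟨v, ?_, w', ?_, h1, ?_⟩
      · exact Finset.mem_sdiff.2 ⟨Finset.mem_filter.2 ⟨Finset.mem_univ _, w', Or.inl hch⟩, hvS⟩
      · exact Finset.mem_sdiff.2 ⟨Finset.mem_filter.2 ⟨Finset.mem_univ _, v, Or.inr hch⟩, hw'S⟩
      -- The chosen neighbour may differ from the announced one, but the solution has only one arc
      -- with this tail, so the labels agree.
      · exact (Prod.ext_iff.1 (hF2.injOn_fst hmem he h1)).2
    intro x hx
    rcases Finset.mem_union.1 hx with hx | hx <;> obtain ⟨e, he, rfl⟩ := Finset.mem_image.1 hx <;>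
      obtain ⟨v, hv, w, hw, h1, h2⟩ := key e he
    · exact Finset.mem_image.2 ⟨v, hv, h1⟩
    · exact Finset.mem_image.2 ⟨w, hw, h2⟩
  have h1 := (Finset.card_le_card hends).trans Finset.card_image_le
  rw [hF2.card_ends fun e he => (hF1 e he).2, Finset.card_sdiff_of_subset hset] at h1
  have h2 := Finset.card_le_card hset
  have h3 := card_settledNodes (m := P.m) h.paired
  omega

theorem mem_port_iff (v : V) (p : Fin (N.deg v)) :
    (nodePort N P s color v = some (p : ℕ) ∨ N.deliver (nodeNotify N P s color) v p ≠ 0) ↔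
      Joined N P s color v (N.nbr v p) := by
  have hl := Network.link_backPort v p
  rw [hl.deliver, nodeNotify, Joined]
  refine or_congr ⟨fun h => ⟨_, _, hl, h⟩, ?_⟩ ?_
  · rintro ⟨p', q', hl', h⟩
    rwa [hl.port_eq hl']
  · constructor
    · intro h
      refine ⟨_, _, hl.symm, ?_⟩
      by_contra hne
      exact h (if_neg hne)
    · rintro ⟨p', q', hl', h⟩
      rw [hl.symm.port_eq hl', if_pos h]
      exact one_ne_zero

/-- Distinct colors are not needed here: the error of the randomized algorithm is one-sided. -/
theorem Valid.outcome_of_solvable (h : Valid N P s color) (hsol : Solvable N P s color) (k : ℕ) :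
    Outcome N P.K k (nodeAnswer N P s color) := by
  left
  have hM := isMatching_matchingOf (G := N.graph) (R := Joined N P s color) (fun v w h => h.adj)
    (fun v w h => h.symm) fun v w w' => Joined.unique h.paired hsol
  refine ⟨_, hM, ?_, ?_⟩
  · have h1 := two_mul_ncard_edgeSet hM
    have h2 := h.card_joined hsol
    rw [← Set.ncard_coe_finset] at h2
    have h3 : (matchingOf (G := N.graph) (Joined N P s color) (fun v w h => h.adj)
      (fun v w h => h.symm)).verts = ((Finset.univ.filter fun v =>
        ∃ w, Joined N P s color v w : Finset V) : Set V) := by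
      ext v; simp [matchingOf]
    rw [h3] at h1
    omega
  · intro v
    exact ⟨_, if_pos hsol, fun p => mem_port_iff v p⟩

/-- If there is a large matching, then enough of its edges avoid the settled nodes. -/
theorem exists_arcs_avoiding (hs : Paired N s) (hsat : Saturated N s) {K m : ℕ} (hm : m ≤ K)
    (hk : HasMatching N.graph (K + m)) : (settled m (matchItems N s)).card = 2 * m ∧
      ∃ F : Finset (V × V), K - m ≤ F.card ∧ ArcDisjoint F ∧ ∀ e ∈ F, N.graph.Adj e.1 e.2 ∧
        e.1 ∈ coverNodes N s m ∧ e.2 ∉ settledNodes N s m := by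
  obtain ⟨F, hF, hdisj, hadj⟩ := exists_arcs_of_hasMatching hk hsat.cover
  -- All tails are matched, so K + m ≥ 2m matched nodes exist and the minimum in `card_settled` is
  -- 2m.
  have h1 := hdisj.card_touching_le (matchedNodes s)
  rw [Finset.filter_true_of_mem fun e he => Or.inl (hadj e he).2] at h1
  have hcard : (settled m (matchItems N s)).card = 2 * m := by
    rw [card_settled hs]; omega
  refine ⟨hcard, F.filter fun e => ¬ (e.1 ∈ settledNodes N s m ∨ e.2 ∈ settledNodes N s m), ?_,
    hdisj.mono (Finset.filter_subset _ _), ?_⟩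
  -- Of K + m disjoint arcs at most 2m touch the settled nodes.
  · have h2 := hdisj.card_touching_le (settledNodes N s m)
    rw [card_settledNodes hs, hcard] at h2
    have h3 := Finset.card_filter_add_card_filter_not (s := F)
      (fun e => e.1 ∈ settledNodes N s m ∨ e.2 ∈ settledNodes N s m)
    omega
  · intro e he
    obtain ⟨he, hn⟩ := Finset.mem_filter.1 he
    rw [not_or] at hn
    exact ⟨(hadj e he).1, mem_coverNodes'.2 ⟨(hadj e he).2, hn.1⟩, hn.2⟩

/-- The arcs are carried over to labels, which are distinct on their ends: cover labels always, the
others through identifiers or through the assumed distinctness of the heads' colors.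
`ArcDisjoint.exists_kept` then redirects the arcs to announced labels. -/
theorem Valid.solvable (h : Valid N P s color) (hm : P.m ≤ P.K)
    (hcard : (settled P.m (matchItems N s)).card = 2 * P.m) {F : Finset (V × V)}
    (hF : P.K - P.m ≤ F.card) (hdisj : ArcDisjoint F) (hadj : ∀ e ∈ F, N.graph.Adj e.1 e.2 ∧
      e.1 ∈ coverNodes N s P.m ∧ e.2 ∉ settledNodes N s P.m)
    (hinj : P.colored → ∀ e ∈ F, ∀ e' ∈ F, color e.2 = color e'.2 → e.2 = e'.2) :
    Solvable N P s color := by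
  set lab : V → ℕ := fun v => nodeLabel N P s color v 0 with hlab
  have hlab_inj : ∀ a b, (∃ e ∈ F, a = e.1 ∨ a = e.2) → (∃ e ∈ F, b = e.1 ∨ b = e.2) →
      lab a = lab b → a = b := by
    intro a b ha hb hab
    have key : ∀ {a}, (∃ e ∈ F, a = e.1 ∨ a = e.2) → a ∈ coverNodes N s P.m ∨
        (a ∉ settledNodes N s P.m ∧ a ∉ coverNodes N s P.m ∧ ∃ e ∈ F, a = e.2) := by
      rintro a ⟨e, he, rfl | rfl⟩
      · exact Or.inl (hadj e he).2.1
      · by_cases hC : e.2 ∈ coverNodes N s P.m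
        · exact Or.inl hC
        · exact Or.inr ⟨(hadj e he).2.2, hC, e, he, rfl⟩
    rcases key ha with ha | ⟨ha1, ha2, e, he, hae⟩ <;> rcases key hb with hb | ⟨hb1, hb2, e', he', hbe⟩
    · exact nodeLabel_injOn ha hb hab
    · simp only [hlab] at hab
      rw [nodeLabel_of_cover ha, nodeLabel_of_other hb1 hb2] at hab
      omega
    · simp only [hlab] at hab
      rw [nodeLabel_of_cover hb, nodeLabel_of_other ha1 ha2] at hab
      omega
    · simp only [hlab] at hab
      rw [nodeLabel_of_other ha1 ha2, nodeLabel_of_other hb1 hb2] at hab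
      split_ifs at hab with hcol
      · rw [hae, hbe]
        refine hinj hcol.1 e he e' he' ?_
        rw [← hae, ← hbe]
        omega
      · exact N.id_injective (by omega)
  obtain ⟨hdisj', hcard'⟩ := hdisj.image lab hlab_inj
  set C := (coverNodes N s P.m).image lab with hC
  have hCcard : C.card ≤ (coverNodes N s P.m).card := Finset.card_image_le
  set keep : ℕ → Finset ℕ := fun a =>
    if h : ∃ v ∈ coverNodes N s P.m, lab v = a then (nodeKept N P s color h.choose).toFinset else ∅
    with hkeep
  have hkeep_lab : ∀ v ∈ coverNodes N s P.m, keep (lab v) = (nodeKept N P s color v).toFinset := by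
    intro v hv
    have hex : ∃ u ∈ coverNodes N s P.m, lab u = lab v := ⟨v, hv, rfl⟩
    have : hex.choose = v := nodeLabel_injOn hex.choose_spec.1 hv hex.choose_spec.2
    rw [hkeep]
    dsimp only
    rw [dif_pos hex, this]
  obtain ⟨F', h1, h2, h3⟩ := ArcDisjoint.exists_kept (C := C) keep _ _ rfl hdisj' (by
    intro e' he'
    obtain ⟨e, he, rfl⟩ := Finset.mem_image.1 he'
    obtain ⟨ha, hc, hs⟩ := hadj e he
    refine ⟨Finset.mem_image.2 ⟨e.1, hc, rfl⟩, fun heq => ha.ne ?_, ?_⟩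
    · exact hlab_inj _ _ ⟨e, he, Or.inl rfl⟩ ⟨e, he, Or.inr rfl⟩ heq
    · change lab e.2 ∈ keep (lab e.1) ∨ 2 * C.card ≤ (keep (lab e.1)).card
      rw [hkeep_lab _ hc, List.mem_toFinset]
      rcases mem_nodeKept_or (P := P) (color := color) ha (nodeLabel_ne_zero.2 hs) with h | h
      · exact Or.inl h
      · exact Or.inr (by omega))
  refine ⟨F', fun e he => ⟨?_, (h3 e he).2.1⟩, h2, by omega⟩
  obtain ⟨hc, -, hk⟩ := h3 e he
  obtain ⟨v, hv, hve⟩ := Finset.mem_image.1 hc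
  rw [← hve, hkeep_lab v hv, List.mem_toFinset] at hk
  exact h.carries_iff.2 ⟨v, hv, hve, hk⟩

/-- The improvement step is correct, if the colors of a few nodes are distinct. -/
theorem exists_outcome (hs : Paired N s) (hsat : Saturated N s) (hm : P.m ≤ P.K) :
    ∃ W : Finset V, W.card ≤ (coverNodes N s P.m).card ∧ ∀ color, Valid N P s color →
      (P.colored → Set.InjOn color W) → Outcome N P.K (P.K + P.m) (nodeAnswer N P s color) := by
  by_cases hk : HasMatching N.graph (P.K + P.m)
  · obtain ⟨hcard, F, hF, hdisj, hadj⟩ := exists_arcs_avoiding hs hsat hm hk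
    -- The arcs, and hence the nodes whose colors matter, are fixed before the colors; the later
    -- union bound relies on this.
    refine ⟨F.image Prod.snd, ?_, fun color hval hinj => ?_⟩
    · exact Finset.card_image_le.trans
        (Finset.card_le_card_of_injOn Prod.fst (fun e he => (hadj e he).2.1) hdisj.injOn_fst)
    · refine hval.outcome_of_solvable (hval.solvable hm hcard hF hdisj hadj ?_) _
      intro hc e he e' he' heq
      exact hinj hc (Finset.mem_coe.2 (Finset.mem_image_of_mem _ he))
        (Finset.mem_coe.2 (Finset.mem_image_of_mem _ he')) heq
  -- Without a matching of size K + m both answers are right: a solution still yields K edges, and a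
  -- report is true.
  · refine ⟨∅, by simp, fun color hval _ => ?_⟩
    by_cases hsol : Solvable N P s color
    · exact hval.outcome_of_solvable hsol _
    · exact Or.inr ⟨fun v => if_neg hsol, hk⟩

end Correctness

/-! ### Execution, message sizes and running time -/

section Execution

open Classical

/-! #### Sizes of the messages -/

theorem pair_lt_pow {q c a b : ℕ} (ha : a < q ^ c) (hb : b < q ^ c) : Nat.pair a b < q ^ (2 * c) := by
  refine (Nat.pair_lt_max_add_one_sq _ _).trans_le ?_
  rw [mul_comm, pow_mul]
  exact Nat.pow_le_pow_left (Nat.succ_le_of_lt (max_lt ha hb)) 2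

variable {V : Type} [Fintype V]

/-- A strict upper bound for all numbers sent by the algorithm. -/
def messageBound (c n : ℕ) : ℕ := (n + 1) ^ (4 * c + 9)

theorem pow_lt_messageBound {c n i : ℕ} (hn : 1 ≤ n) (hi : i ≤ 4 * c + 8) :
    (n + 1) ^ i < messageBound c n :=
  Nat.pow_lt_pow_right (by omega) (by omega)

variable {N : Network V} {P : Params} {s : V → Option ℕ} {color : V → ℕ}

theorem card_pos_of_node (v : V) : 1 ≤ Fintype.card V := Fintype.card_pos_iff.2 ⟨v⟩

theorem id_lt_succ_pow {c : ℕ} {i : ℕ} (h : i < Fintype.card V ^ c) :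
    i < (Fintype.card V + 1) ^ c :=
  h.trans_le (Nat.pow_le_pow_left (Nat.le_succ _) c)

theorem packItem_lt {c i j : ℕ} (hc : 1 ≤ c) (hi : i < Fintype.card V ^ c)
    (hj : j < Fintype.card V ^ c) (v : V) :
    packItem i j (N.deg v) < messageBound c (Fintype.card V) := by
  have hd : N.deg v < (Fintype.card V + 1) ^ c := by
    refine (N.deg_lt_card v).trans ((Nat.lt_succ_self _).trans_le ?_)
    exact Nat.le_self_pow (by omega) _
  have h1 := pair_lt_pow (id_lt_succ_pow hj) hd
  have h2 : i < (Fintype.card V + 1) ^ (2 * c) :=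
    (id_lt_succ_pow hi).trans_le (Nat.pow_le_pow_right (by omega) (by omega))
  exact (Nat.succ_le_of_lt (pair_lt_pow h2 h1)).trans_lt
    (pow_lt_messageBound (card_pos_of_node v) (by omega))

theorem Valid.nodeLabel_lt (h : Valid N P s color) (v : V) (i : ℕ) :
    nodeLabel N P s color v i < (Fintype.card V + 1) ^ (2 * P.c + 4) := by
  set n := Fintype.card V with hn
  have hn1 : 1 ≤ n := card_pos_of_node v
  have hle : ∀ i ≤ 2 * P.c + 4, (n + 1) ^ i ≤ (n + 1) ^ (2 * P.c + 4) := fun i hi =>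
    Nat.pow_le_pow_right (by omega) hi
  by_cases hv : v ∈ settledNodes N s P.m
  · rw [nodeLabel_of_settled hv]
    positivity
  by_cases hv' : v ∈ coverNodes N s P.m
  · have h1 := rank_lt hv'
    have h2 := (coverNodes N s P.m).card_le_univ
    have h3 := hle 2 (by omega)
    rw [nodeLabel_of_cover hv']
    nlinarith
  · rw [nodeLabel_of_other hv hv']
    split_ifs with hcol
    · have h1 := h.color_lt v
      have h2 := hcol.2.trans (sizeEstimate_le N s)
      have h3 := hle 2 (by omega)
      rw [pow_add] at h2
      nlinarith
    · have h1 := id_lt_succ_pow (h.id_lt v)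
      have h3 := hle (P.c + 2) (by omega)
      rw [← hn] at h1
      have h4 : 2 * (n + 1) ^ P.c < (n + 1) ^ (P.c + 2) := by
        rw [pow_add, mul_comm]
        exact Nat.mul_lt_mul_of_pos_left (by nlinarith) (by positivity)
      omega

theorem Valid.nodePackets_lt (h : Valid N P s color) {v : V} {y : ℕ}
    (hy : y ∈ nodePackets N P s color v) : y < messageBound P.c (Fintype.card V) := by
  obtain ⟨hv, hy⟩ := of_mem_nodePackets hy
  have hne : (matchItems N s).Nonempty := ⟨_, Finset.mem_image_of_mem _ (mem_coverNodes'.1 hv).1⟩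
  -- Both components of a packet are bounded by this power; pairing doubles the exponent to 4c + 8.
  refine (lt_of_mem_packets (A := (Fintype.card V + 1) ^ (2 * P.c + 4))
    (h.one_lt_base (h.one_lt_card_of_cover hv)) (fun x hx => h.nodeKept_lt hx) hy
    (h.nodeLabel_lt v 0) ?_).trans_lt ?_
  · refine (base_pow_packetSize_le P hne).trans ?_
    have h1 : sizeEstimate (matchItems N s) ≤ (Fintype.card V + 1) ^ 2 :=
      (sizeEstimate_le N s).trans (Nat.pow_le_pow_left (Nat.le_succ _) 2)
    calc 3 * sizeEstimate (matchItems N s) ^ (P.c + 1)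
        ≤ (Fintype.card V + 1) ^ 2 * ((Fintype.card V + 1) ^ 2) ^ (P.c + 1) := by
          refine Nat.mul_le_mul ?_ (Nat.pow_le_pow_left h1 _)
          have := card_pos_of_node v
          nlinarith
      _ = (Fintype.card V + 1) ^ (2 * P.c + 4) := by rw [← pow_mul, ← pow_add]; congr 1; ring
  · rw [← pow_mul]
    exact pow_lt_messageBound (card_pos_of_node v) (by omega)

theorem zero_notMem_nodePackets (v : V) : 0 ∉ nodePackets N P s color v := by
  intro h
  obtain ⟨j, _, h0⟩ := mem_packets (of_mem_nodePackets h).2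
  omega

/-- The execution of the second part of the algorithm. -/
theorem Valid.exec_improve (h : Valid N P s color) (hK : (matchedNodes s).card < 2 * P.K) :
    Exec N (messageBound P.c (Fintype.card V)) (P.packetRounds (matchItems N s) + (0 + 1) + 1)
      (fun v => P.improve (matchItems N s) (color v) (N.deg v) (N.id v) (s v))
      (nodeAnswer N P s color) := by
  have hpos : 1 ≤ Fintype.card V := by
    have := h.connected.nonempty
    exact Fintype.card_pos
  have hone : 1 < messageBound P.c (Fintype.card V) :=
    pow_lt_messageBound (i := 0) hpos (by omega)
  -- A distance above 4K would require 2K matched nodes near `v`, but there are fewer in total.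
  have hwalk : ∀ v u, ∃ w : N.graph.Walk v u, w.length ≤ 4 * P.K := by
    intro v
    rcases forall_walk_or_exists_cover h.connected h.saturated.cover (2 * P.K) v with h1 | ⟨Y, h1, h2, _⟩
    · intro u
      obtain ⟨w, hw⟩ := h1 u
      exact ⟨w, by omega⟩
    · have := Finset.card_le_card h1
      omega
  have hY : ∀ v, (gossipState N (nodePackets N P s color) (P.packetRounds (matchItems N s)) v).1
      = allItems (nodePackets N P s color) := fun v =>
    gossipState_fst_eq_allItems zero_notMem_nodePackets (hwalk v) (by
      have := card_allItems_nodePackets_le N P s color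
      rw [Params.packetRounds, card_coverIds]
      omega)
  refine Exec.step (nodeLabel N P s color) _ (fun v p _ => (h.nodeLabel_lt v p).trans
    (pow_lt_messageBound hpos (by omega))) ?_
  refine exec_gossip N (by omega) _ (nodePackets N P s color) (fun v y hy => h.nodePackets_lt hy) ?_
  simp only [hY]
  refine Exec.step (nodeNotify N P s color) _ (fun v p _ => ?_) (Exec.done _)
  unfold nodeNotify
  split_ifs <;> omega

/-! #### The first part of the algorithm -/

variable (N s) in
/-- The message which tells whether a node is free. -/
noncomputable def status (v : V) (_ : ℕ) : ℕ := Nat.pair (N.id v) (if s v = none then 1 else 0) + 1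

variable (N s) in
/-- The items spread by a node. -/
noncomputable def nodeItems (v : V) : Finset ℕ :=
  Params.ownItems (N.deg v) (N.id v) (s v) (N.deliver (status N s) v)

theorem Paired.nodeItems_of_matched (hs : Paired N s) {v : V} (hv : v ∈ matchedNodes s) :
    nodeItems N s v = {matchItem N s v} := by
  obtain ⟨p, q, hl, hp, _⟩ := hs.link_mate' hv
  rw [nodeItems, hp, Params.ownItems, hl.deliver, status, matchItem]
  simp

theorem nodeItems_of_free {v : V} (hv : s v = none) : nodeItems N s v =
    if ∃ w, N.graph.Adj v w ∧ s w = none then {packItem (N.id v) (N.id v) (N.deg v)} else ∅ := by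
  rw [nodeItems, hv, Params.ownItems]
  refine if_congr ⟨?_, ?_⟩ rfl rfl
  · rintro ⟨p, hp, h⟩
    obtain ⟨w, q, hl, heq⟩ := Network.deliver_ne_zero hp
    rw [heq, status] at h
    refine ⟨w, hl.adj, ?_⟩
    by_contra hw
    simp [hw] at h
  · rintro ⟨w, hadj, hw⟩
    obtain ⟨p, q, hl⟩ := Network.exists_link_of_adj hadj
    refine ⟨p, ?_⟩
    rw [hl.deliver, status]
    simp [hw]

theorem Paired.of_mem_nodeItems (hs : Paired N s) {v : V} {y : ℕ} (hy : y ∈ nodeItems N s v) :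
    ∃ w, y = packItem (N.id v) (N.id w) (N.deg v) := by
  by_cases hv : v ∈ matchedNodes s
  · rw [hs.nodeItems_of_matched hv, Finset.mem_singleton] at hy
    exact ⟨_, hy⟩
  · rw [nodeItems_of_free (by simpa [mem_matchedNodes] using hv)] at hy
    split_ifs at hy
    · exact ⟨v, Finset.mem_singleton.1 hy⟩
    · exact absurd hy (Finset.notMem_empty _)

theorem Paired.zero_notMem_nodeItems (hs : Paired N s) (v : V) : 0 ∉ nodeItems N s v := by
  intro h
  obtain ⟨w, hw⟩ := hs.of_mem_nodeItems h
  simp [packItem] at hw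

theorem Paired.allItems_nodeItems (hs : Paired N s) (hsat : Saturated N s) :
    allItems (nodeItems N s) = matchItems N s := by
  ext y
  rw [allItems, Finset.mem_biUnion, matchItems, Finset.mem_image]
  constructor
  · rintro ⟨v, _, hy⟩
    by_cases hv : v ∈ matchedNodes s
    · rw [hs.nodeItems_of_matched hv, Finset.mem_singleton] at hy
      exact ⟨v, hv, hy.symm⟩
    · have hv' : s v = none := by simpa [mem_matchedNodes] using hv
      rw [nodeItems_of_free hv', if_neg] at hy
      · exact absurd hy (Finset.notMem_empty _)
      · rintro ⟨w, hw, hw'⟩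
        exact hsat v w hw hv' hw'
  · rintro ⟨v, hv, rfl⟩
    refine ⟨v, Finset.mem_univ v, ?_⟩
    rw [hs.nodeItems_of_matched hv]
    exact Finset.mem_singleton_self _

variable (N s) in
/-- The nodes which spread an item. -/
noncomputable def sources : Finset V := Finset.univ.filter fun v => (nodeItems N s v).Nonempty

theorem Paired.mem_sources (hs : Paired N s) {v : V} (hv : v ∈ matchedNodes s) :
    v ∈ sources N s := by
  refine Finset.mem_filter.2 ⟨Finset.mem_univ v, ?_⟩
  rw [hs.nodeItems_of_matched hv]
  exact Finset.singleton_nonempty _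

theorem Paired.sources_cover (hs : Paired N s) (v w : V) (h : N.graph.Adj v w) :
    v ∈ sources N s ∨ w ∈ sources N s := by
  by_cases hv : v ∈ matchedNodes s
  · exact Or.inl (hs.mem_sources hv)
  by_cases hw : w ∈ matchedNodes s
  · exact Or.inr (hs.mem_sources hw)
  rw [mem_matchedNodes, not_not] at hv hw
  refine Or.inl (Finset.mem_filter.2 ⟨Finset.mem_univ v, ?_⟩)
  rw [nodeItems_of_free hv, if_pos ⟨w, h, hw⟩]
  exact Finset.singleton_nonempty _

theorem Paired.card_le_of_items_subset (hs : Paired N s) {Y : Finset V} (hY : Y ⊆ sources N s)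
    {A : Finset ℕ} (hA : ∀ v ∈ Y, nodeItems N s v ⊆ A) : Y.card ≤ A.card := by
  have : Y.image N.id ⊆ A.image itemId := by
    intro i hi
    obtain ⟨v, hv, rfl⟩ := Finset.mem_image.1 hi
    obtain ⟨y, hy⟩ := (Finset.mem_filter.1 (hY hv)).2
    obtain ⟨w, hw⟩ := hs.of_mem_nodeItems hy
    exact Finset.mem_image.2 ⟨y, hA v hv hy, by rw [hw, itemId_packItem]⟩
  rw [← Finset.card_image_of_injective Y N.id_injective]
  exact (Finset.card_le_card this).trans Finset.card_image_le

/-- After the first gossip, either all nodes know many items, or all nodes know all items. -/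
theorem Paired.gossip_dichotomy (hs : Paired N s) (hconn : N.graph.Connected) (K : ℕ) (v : V) :
    (2 * K ≤ (allItems (nodeItems N s)).card →
      2 * K ≤ (gossipState N (nodeItems N s) (6 * K) v).1.card) ∧
    ((allItems (nodeItems N s)).card < 2 * K →
      (gossipState N (nodeItems N s) (6 * K) v).1 = allItems (nodeItems N s)) := by
  have hwalk := forall_walk_or_exists_cover hconn hs.sources_cover (2 * K) v
  constructor
  · intro hlarge
    by_contra! hlt
    -- An item missing from distance at most 4K after 6K rounds would force more than 2K known
    -- items.
    have hnear : ∀ u, (∃ w : N.graph.Walk v u, w.length ≤ 2 * (2 * K)) →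
        nodeItems N s u ⊆ (gossipState N (nodeItems N s) (6 * K) v).1 := by
      rintro u ⟨w, hw⟩
      exact (items_subset_or_le_card hs.zero_notMem_nodeItems w (6 * K)).resolve_right (by omega)
    rcases hwalk with h | ⟨Y, h1, h2, h3⟩
    · have hsub : allItems (nodeItems N s) ⊆ (gossipState N (nodeItems N s) (6 * K) v).1 :=
        Finset.biUnion_subset.2 fun u _ => hnear u (h u)
      have := Finset.card_le_card hsub
      omega
    · have := hs.card_le_of_items_subset h1 fun u hu => hnear u (h3 u hu)
      omega
  · intro hsmall
    rcases hwalk with h | ⟨Y, h1, h2, h3⟩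
    · exact gossipState_fst_eq_allItems hs.zero_notMem_nodeItems h (by omega)
    · have := hs.card_le_of_items_subset h1 (A := allItems (nodeItems N s)) fun u _ y hy =>
        Finset.mem_biUnion.2 ⟨u, Finset.mem_univ u, hy⟩
      omega

theorem Paired.outcome (hs : Paired N s) {K : ℕ} (hK : 2 * K ≤ (matchedNodes s).card) (k : ℕ) :
    Outcome N K k fun v => .matched {p | s v = some p} := by
  obtain ⟨M, hM, hcard, hadj⟩ := hs.exists_matching
  refine Or.inl ⟨M, hM, by omega, fun v => ⟨_, rfl, fun p => ?_⟩⟩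
  rw [hadj]
  have hl := Network.link_backPort v p
  constructor
  · exact fun h => ⟨_, _, hl, h⟩
  · rintro ⟨p', q', hl', h⟩
    rw [Set.mem_ofPred_eq, hl.port_eq hl']
    exact h

theorem exec_first {t : ℕ} {out : V → Answer} (hc : 1 ≤ P.c)
    (hid : ∀ v, N.id v < Fintype.card V ^ P.c) (hconn : N.graph.Connected)
    (h : Exec N (messageBound P.c (Fintype.card V)) t (fun v =>
      if 2 * P.K ≤ (gossipState N (nodeItems N (greedyMatching N P.K)) (6 * P.K) v).1.card then
        .done (.matched {p | greedyMatching N P.K v = some p})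
      else P.improve (gossipState N (nodeItems N (greedyMatching N P.K)) (6 * P.K) v).1 (color v)
        (N.deg v) (N.id v) (greedyMatching N P.K v)) out) :
    Exec N (messageBound P.c (Fintype.card V)) (2 * P.K + (6 * P.K + t + 1))
      (fun v => P.program (color v) (N.deg v) (N.id v)) out := by
  have hpos : 1 ≤ Fintype.card V := by
    have := hconn.nonempty
    exact Fintype.card_pos
  have hs := paired_greedyMatching (N := N) P.K
  refine exec_greedy N (fun v => ?_) P.K (fun _ => none) ?_
  · exact (Nat.succ_le_of_lt (id_lt_succ_pow (hid v))).trans_lt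
      (pow_lt_messageBound hpos (by omega))
  refine Exec.step (status N (greedyMatching N P.K)) _ (fun v p _ => ?_) ?_
  · have h1 : (if greedyMatching N P.K v = none then 1 else 0) < (Fintype.card V + 1) ^ P.c := by
      have := Nat.one_lt_pow (show P.c ≠ 0 by omega) (show 1 < Fintype.card V + 1 by omega)
      split_ifs <;> omega
    exact (Nat.succ_le_of_lt (pair_lt_pow (id_lt_succ_pow (hid v)) h1)).trans_lt
      (pow_lt_messageBound hpos (by omega))
  · refine exec_gossip N (Nat.zero_lt_of_lt (pow_lt_messageBound (i := 0) hpos (by omega)))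
      (6 * P.K) (nodeItems N (greedyMatching N P.K)) (fun v y hy => ?_) h
    obtain ⟨w, rfl⟩ := hs.of_mem_nodeItems hy
    exact packItem_lt hc (hid v) (hid w) v

/-- The execution of the algorithm, its running time, and the correctness of its answers. -/
theorem exec_program (hc : 1 ≤ P.c) (hm : P.m ≤ P.K)
    (hid : ∀ v, N.id v < Fintype.card V ^ P.c) (hconn : N.graph.Connected)
    (hl : P.colored → 2 * (P.K - P.m) ≤ 2 ^ P.l) :
    ∃ (q p : ℕ) (W : Finset V), q ≤ 2 * (P.K - P.m) ∧ q ≤ Fintype.card V ∧ 0 < p ∧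
      (P.colored → Nat.log 2 (Fintype.card V) < 2 * p * (P.l + 2)) ∧ W.card ≤ 2 * (P.K - P.m) ∧
      ∃ t ≤ 12 * P.K + 3 + q * (2 * q / p + 1), ∀ color : V → ℕ, (∀ v, color v < 2 ^ P.l) →
        ∃ out, Exec N (messageBound P.c (Fintype.card V)) t
          (fun v => P.program (color v) (N.deg v) (N.id v)) out ∧
          ((P.colored → Set.InjOn color W) → Outcome N P.K (P.K + P.m) out) := by
  have hs := paired_greedyMatching (N := N) P.K
  have hor := saturated_or_card_le (N := N) P.K
  set s := greedyMatching N P.K with hsdef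
  by_cases hlarge : 2 * P.K ≤ (allItems (nodeItems N s)).card
  -- There is no second phase: `q = 0` makes its cost vanish, and `p` is only chosen to meet the
  -- logarithmic bound.
  · refine ⟨0, Nat.log 2 (Fintype.card V) + 1, ∅, by omega, by omega, by omega, fun _ => ?_,
      by simp, 2 * P.K + (6 * P.K + 0 + 1), by omega, fun color _ => ⟨_, exec_first hc hid hconn
      (by simp only [← hsdef, ((hs.gossip_dichotomy hconn P.K _).1 hlarge), if_true]
          exact Exec.done _), fun _ => ?_⟩⟩
    · nlinarith
    · refine hs.outcome ?_ _
      rcases hor with h | h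
      · rwa [hs.allItems_nodeItems h, card_matchItems] at hlarge
      · exact h
  · push Not at hlarge
    -- Otherwise the greedy algorithm would have matched 2K nodes, each with an item of its own.
    have hsat : Saturated N s := by
      rcases hor with h | h
      · exact h
      · have := hs.card_le_of_items_subset (fun v hv => hs.mem_sources hv)
          (A := allItems (nodeItems N s)) fun u (_ : u ∈ matchedNodes s) y hy =>
            Finset.mem_biUnion.2 ⟨u, Finset.mem_univ u, hy⟩
        omega
    have hall := hs.allItems_nodeItems hsat
    have hcard : (matchedNodes s).card < 2 * P.K := by
      rwa [hall, card_matchItems] at hlarge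
    have hcov := card_coverNodes (m := P.m) hs
    obtain ⟨W, hW, hout⟩ := exists_outcome (P := P) hs hsat hm
    have hvalid : ∀ color : V → ℕ, (∀ v, color v < 2 ^ P.l) → Valid N P s color := fun color h =>
      ⟨hs, hsat, hconn, hc, hid, h, fun h' => by have := hl h'; omega⟩
    refine ⟨(coverNodes N s P.m).card, P.packetSize (matchItems N s), W, by omega,
      Finset.card_le_univ _, packetSize_pos _ _, fun hcol => ?_, by omega,
      2 * P.K + (6 * P.K + (P.packetRounds (matchItems N s) + (0 + 1) + 1) + 1), ?_,
      fun color hcolor => ⟨nodeAnswer N P s color, exec_first hc hid hconn ?_,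
        fun hinj => hout color (hvalid color hcolor) hinj⟩⟩
    -- Rounding down a quotient that is at least 1 loses less than a factor 2. If colors are not
    -- used, the size estimate is below `2 ^ (l + 2)` and packets of one label suffice.
    · have hlog : Nat.log 2 (Fintype.card V) ≤ Nat.log 2 (sizeEstimate (matchItems N s)) := by
        by_cases hn : 1 < Fintype.card V
        · exact Nat.log_mono_right (card_le_sizeEstimate hsat hconn hn)
        · rw [Nat.log_of_lt (by omega)]
          omega
      have hpos := packetSize_pos P (matchItems N s)
      by_cases hu : P.UsesColors (matchItems N s)
      · have h1 : P.packetSize (matchItems N s) =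
            Nat.log 2 (sizeEstimate (matchItems N s)) / (P.l + 2) := if_pos hu
        have h2 := Nat.lt_mul_div_succ (Nat.log 2 (sizeEstimate (matchItems N s)))
          (show 0 < P.l + 2 by omega)
        rw [← h1] at h2
        nlinarith
      · have h1 : sizeEstimate (matchItems N s) < 2 ^ (P.l + 2) :=
          not_le.1 fun h => hu ⟨hcol, h⟩
        have h2 : Nat.log 2 (sizeEstimate (matchItems N s)) < P.l + 2 :=
          Nat.log_lt_of_lt_pow' (by omega) h1
        nlinarith
    · rw [Params.packetRounds, card_coverIds]
      omega
    · have hG : ∀ v, (gossipState N (nodeItems N s) (6 * P.K) v).1 = matchItems N s := fun v => by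
        rw [(hs.gossip_dichotomy hconn P.K v).2 hlarge, hall]
      rw [hall] at hlarge
      simp only [← hsdef, hG, if_neg (not_le.2 hlarge)]
      exact (hvalid color hcolor).exec_improve hcard

end Execution

/-! ### Random colors -/

section Probability

variable {V I : Type} [Fintype V] [Fintype I]

/-- Two nodes get the same input with probability at most `1 / |I|`. -/
theorem ncard_eq_mul_le {v w : V} (hvw : v ≠ w) :
    {x : V → I | x v = x w}.ncard * Nat.card I ≤ Nat.card (V → I) := by
  classical
  rw [← Nat.card_coe_set_eq, ← Nat.card_prod]
  refine Nat.card_le_card_of_injective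
    -- Overwriting the input of `v` loses nothing, since it can be read off at `w`.
    (fun y : {x : V → I | x v = x w} × I => Function.update y.1.1 v y.2) ?_
  rintro ⟨⟨x, hx⟩, i⟩ ⟨⟨y, hy⟩, j⟩ h
  have hx : x v = x w := hx
  have hy : y v = y w := hy
  have h' : ∀ u, Function.update x v i u = Function.update y v j u := fun u => congrFun h u
  have hij : i = j := by simpa using h' v
  have hne : ∀ u, u ≠ v → x u = y u := fun u hu => by simpa [hu] using h' u
  have hxy : x = y := by
    funext u
    by_cases hu : u = v
    · rw [hu, hx, hy]
      exact hne w hvw.symm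
    · exact hne u hu
  subst hij hxy
  rfl

/-- The inputs of the nodes in `W` are distinct, up to a probability of `|W| ^ 2 / |I|`. -/
theorem uniformProb_not_injOn_le [Nonempty I] (W : Finset V) {E : Set (V → I)}
    (hE : ∀ x ∈ E, ¬ Set.InjOn x W) :
    uniformProb E ≤ (W.card : ℝ) ^ 2 / (Nat.card I : ℝ) := by
  classical
  set D : Finset (V × V) := (W ×ˢ W).filter fun e => e.1 ≠ e.2
  have hsub : E ⊆ ⋃ e ∈ D, {x : V → I | x e.1 = x e.2} := by
    intro x hx
    have := hE x hx
    simp only [Set.InjOn, not_forall] at this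
    obtain ⟨v, hv, w, hw, h, hne⟩ := this
    simp only [Set.mem_iUnion]
    exact ⟨(v, w), Finset.mem_filter.2 ⟨Finset.mem_product.2 ⟨hv, hw⟩, hne⟩, h⟩
  have h1 : E.ncard ≤ ∑ e ∈ D, {x : V → I | x e.1 = x e.2}.ncard :=
    (Set.ncard_le_ncard hsub (Set.toFinite _)).trans (Finset.set_ncard_biUnion_le _ _)
  have h2 : E.ncard * Nat.card I ≤ W.card ^ 2 * Nat.card (V → I) := by
    calc E.ncard * Nat.card I
        ≤ (∑ e ∈ D, {x : V → I | x e.1 = x e.2}.ncard) * Nat.card I := Nat.mul_le_mul_right _ h1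
      _ = ∑ e ∈ D, {x : V → I | x e.1 = x e.2}.ncard * Nat.card I := Finset.sum_mul _ _ _
      _ ≤ D.card • Nat.card (V → I) := Finset.sum_le_card_nsmul _ _ _ fun e he =>
          ncard_eq_mul_le (Finset.mem_filter.1 he).2
      _ ≤ W.card ^ 2 * Nat.card (V → I) := by
          rw [smul_eq_mul, sq, ← Finset.card_product]
          exact Nat.mul_le_mul_right _ (Finset.card_filter_le _ _)
  have hI : (0 : ℝ) < Nat.card I := by exact_mod_cast Nat.card_pos
  have hVI : (0 : ℝ) < Nat.card (V → I) := by exact_mod_cast Nat.card_pos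
  rw [uniformProb, div_le_div_iff₀ hVI hI]
  exact_mod_cast h2

end Probability

/-! ### The algorithm in the CONGEST model -/

/-- From n + 1 ≤ 2^(2⌊log₂ n⌋), which doubles the exponent 4c + 9; this is the origin of B = 8c +
18. -/
theorem messageBound_le {c n : ℕ} (hn : 1 < n) :
    messageBound c n ≤ 2 ^ ((8 * c + 18) * Nat.log 2 n) := by
  have h1 : n + 1 ≤ 2 ^ (2 * Nat.log 2 n) := by
    have h2 : n < 2 ^ (Nat.log 2 n + 1) := Nat.lt_pow_succ_log_self one_lt_two n
    have h3 : 1 ≤ Nat.log 2 n := Nat.le_log_of_pow_le one_lt_two (by omega)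
    exact (Nat.succ_le_of_lt h2).trans (Nat.pow_le_pow_right two_pos (by omega))
  refine (Nat.pow_le_pow_left h1 _).trans_eq ?_
  rw [← pow_mul]
  congr 1
  ring

/-- The algorithm, where `color` extracts a color from the private input of a node. -/
noncomputable def Params.algorithm {I : Type} (P : Params) (color : I → ℕ) : Algorithm I :=
  Prog.toAlgorithm fun x deg ident => P.program (color x) deg ident

theorem Outcome.isApproxSolution {V : Type} {N : Network V} {K k : ℕ} {α : ℝ} {out : V → Answer}
    (h : Outcome N K k out) (hK : (k : ℝ) / α ≤ K) : IsApproxSolution N k α out := by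
  refine h.imp ?_ id
  rintro ⟨M, hM, hcard, hout⟩
  exact ⟨M, hM, hK.trans (by exact_mod_cast hcard), hout⟩

theorem algorithm_spec {V I : Type} [Fintype V] {N : Network V} {P : Params} {color : I → ℕ}
    {α : ℝ} (hc : 1 ≤ P.c) (hm : P.m ≤ P.K) (hcolor : ∀ i, color i < 2 ^ P.l)
    (hid : ∀ v, N.id v < Fintype.card V ^ P.c) (hconn : N.graph.Connected)
    (hl : P.colored → 2 * (P.K - P.m) ≤ 2 ^ P.l) (hK : ((P.K + P.m : ℕ) : ℝ) / α ≤ P.K) :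
    (∀ x : V → I, (P.algorithm color).RespectsBandwidth N x
      ((8 * P.c + 18) * Nat.log 2 (Fintype.card V))) ∧
    ∃ (q p : ℕ) (W : Finset V), q ≤ 2 * (P.K - P.m) ∧ q ≤ Fintype.card V ∧ 0 < p ∧
      (P.colored → Nat.log 2 (Fintype.card V) < 2 * p * (P.l + 2)) ∧ W.card ≤ 2 * (P.K - P.m) ∧
      ∃ t ≤ 12 * P.K + 3 + q * (2 * q / p + 1), ∀ x : V → I,
        (P.algorithm color).TerminatesBy N x t ∧
        ((P.colored → Set.InjOn (fun v => color (x v)) W) →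
          (P.algorithm color).Succeeds N (P.K + P.m) α x t) := by
  obtain ⟨q, p, W, hq, hq', hp, hcol, hW, t, ht, hexec⟩ := exec_program hc hm hid hconn hl
  constructor
  · intro x
    obtain ⟨out, hrun, _⟩ := hexec (fun v => color (x v)) fun v => hcolor _
    by_cases hn : 1 < Fintype.card V
    · have := (hrun.run (messageBound_le hn)
        (fun x deg ident => P.program (color x) deg ident) x 0 rfl).2
      intro j v p
      have h := this j v p
      rw [zero_add] at h
      exact h
    -- The bandwidth is 0 here, but a single node has no ports.
    · intro t v p
      have := N.deg_lt_card v
      have := p.2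
      omega
  · refine ⟨q, p, W, hq, hq', hp, hcol, hW, t, ht, fun x => ?_⟩
    obtain ⟨out, hrun, hout⟩ := hexec (fun v => color (x v)) fun v => hcolor _
    -- Only the final states are used, so a crude bit bound is enough.
    have hend := (hrun.run (b := messageBound P.c (Fintype.card V)) Nat.lt_two_pow_self.le
      (fun x deg ident => P.program (color x) deg ident) x 0 rfl).1 t le_rfl
    rw [zero_add] at hend
    have hend' : ∀ v, (P.algorithm color).output ((P.algorithm color).run N x t v)
        = some (out v) := fun v => congrArg (P.algorithm color).output (congrFun hend v)
    refine ⟨fun v => ?_, fun hinj => ⟨out, hend', (hout hinj).isApproxSolution hK⟩⟩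
    rw [hend' v]
    rfl

/-! ### The choice of the parameters -/

theorem exists_split {k : ℕ} {ε : ℝ} (hk : 1 ≤ k) (hε : ε ∈ Set.Icc (1 / (k : ℝ)) 1) :
    ∃ K m : ℕ, K + m = k ∧ m ≤ K ∧ (k : ℝ) / (2 - ε) ≤ K ∧ ((K - m : ℕ) : ℝ) ≤ 3 * (k * ε) := by
  obtain ⟨h1, h2⟩ := hε
  have hk0 : (0 : ℝ) < k := by exact_mod_cast hk
  have hkε : 1 ≤ (k : ℝ) * ε := by rwa [div_le_iff₀' hk0] at h1
  have hε0 : 0 < ε := pos_of_mul_pos_right (by linarith) hk0.le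
  have h3 : (0 : ℝ) < 2 - ε := by linarith
  -- The real number with k - y = k/(2-ε). Then k - 2y ≤ kε, and taking the floor adds at most 2 ≤
  -- 2kε.
  set y : ℝ := k * (1 - ε) / (2 - ε) with hy
  have hy0 : 0 ≤ y := div_nonneg (mul_nonneg hk0.le (by linarith)) h3.le
  have hy2 : 2 * y ≤ k := by
    rw [hy, ← mul_div_assoc, div_le_iff₀ h3]
    nlinarith
  have hfloor := Nat.floor_le hy0
  have hlt := Nat.lt_floor_add_one y
  have hsum : (k : ℝ) / (2 - ε) + y = k := by
    rw [hy, ← add_div, div_eq_iff h3.ne']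
    ring
  have hm : 2 * ⌊y⌋₊ ≤ k := by
    have : ((2 * ⌊y⌋₊ : ℕ) : ℝ) ≤ k := by push_cast; linarith
    exact_mod_cast this
  refine ⟨k - ⌊y⌋₊, ⌊y⌋₊, by omega, by omega, ?_, ?_⟩
  · rw [Nat.cast_sub (by omega)]
    linarith
  · rw [Nat.cast_sub (by omega), Nat.cast_sub (by omega)]
    have hle : (k : ℝ) / (2 - ε) * (1 - ε) ≤ k * (1 - ε) := by
      refine mul_le_mul_of_nonneg_right ?_ (by linarith)
      exact div_le_self hk0.le (by linarith)
    have hy' : y = (k : ℝ) / (2 - ε) * (1 - ε) := by rw [hy]; ring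
    have : (k : ℝ) - 2 * y ≤ k * ε := by
      have h4 : (k : ℝ) - 2 * y = k * ε / (2 - ε) := by
        rw [hy, eq_div_iff h3.ne']
        field_simp
        ring
      rw [h4]
      exact div_le_self (by positivity) (by linarith)
    linarith

theorem rounds_le {K k q p d t : ℕ} {κ : ℝ} (hk : 1 ≤ k) (hK : K ≤ k) (hq : q ≤ 2 * d)
    (hd : (d : ℝ) ≤ 3 * κ) (ht : t ≤ 12 * K + 3 + q * (2 * q / p + 1)) :
    (t : ℝ) ≤ 108 * (k + κ ^ 2) := by
  have h1 : 2 * q / p ≤ 2 * q := Nat.div_le_self _ _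
  have h2 : q * (2 * q / p + 1) ≤ 3 * q ^ 2 := by
    rcases Nat.eq_zero_or_pos q with rfl | hq0
    · simp
    · nlinarith
  have h3 : (t : ℝ) ≤ 15 * k + 3 * (q : ℝ) ^ 2 := by
    have : t ≤ 15 * k + 3 * q ^ 2 := by omega
    exact_mod_cast this
  have h4 : (q : ℝ) ≤ 6 * κ := by
    have : (q : ℝ) ≤ 2 * d := by exact_mod_cast hq
    linarith
  have h5 : (q : ℝ) ^ 2 ≤ (6 * κ) ^ 2 := pow_le_pow_left₀ (Nat.cast_nonneg q) h4 2
  have h6 : (0 : ℝ) ≤ k := Nat.cast_nonneg k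
  nlinarith

/-- The algorithm without colors succeeds for all inputs. -/
theorem plain_algorithm_spec {c k K m : ℕ} {ε : ℝ} (hc : 1 ≤ c) (hk : 1 ≤ k) (hKm : K + m = k)
    (hm : m ≤ K) (hK : (k : ℝ) / (2 - ε) ≤ K) (hd : ((K - m : ℕ) : ℝ) ≤ 3 * (k * ε))
    {V I : Type} [Fintype V] {N : Network V} (hconn : N.graph.Connected)
    (hid : ∀ v, N.id v < Fintype.card V ^ c) :
    (∀ x : V → I, ((⟨c, K, m, 0, False⟩ : Params).algorithm fun _ => 0).RespectsBandwidth N x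
      ((8 * c + 18) * Nat.log 2 (Fintype.card V))) ∧
    ∃ t : ℕ, (t : ℝ) ≤ 108 * (k + (k * ε) ^ 2) ∧ ∀ x : V → I,
      ((⟨c, K, m, 0, False⟩ : Params).algorithm fun _ => 0).TerminatesBy N x t ∧
      ((⟨c, K, m, 0, False⟩ : Params).algorithm fun _ => 0).Succeeds N k (2 - ε) x t := by
  obtain ⟨h1, q, p, W, hq, -, -, -, -, t, ht, h⟩ := algorithm_spec (I := I)
    (P := ⟨c, K, m, 0, False⟩) (color := fun _ => 0) (α := 2 - ε) hc hm (fun _ => by simp) hid hconn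
    (fun h => h.elim) (by rw [hKm]; exact hK)
  refine ⟨h1, t, rounds_le hk (show K ≤ k by omega) hq hd ht, fun x => ⟨(h x).1, ?_⟩⟩
  rw [← hKm]
  exact (h x).2 fun h => h.elim

/-- A length for the random colors. -/
theorem exists_color_length {a κ : ℝ} (ha : 0 < a) (hκ : 2 ≤ κ) :
    ∃ l : ℕ, 36 * κ ^ (2 + a) ≤ 2 ^ l ∧ ((l : ℝ) + 2) * Real.log 2 ≤ (11 + a) * Real.log κ := by
  have hκ0 : 0 < κ := by linarith
  have hlog2 : 0 < Real.log 2 := Real.log_pos one_lt_two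
  have hlogκ : Real.log 2 ≤ Real.log κ := Real.log_le_log two_pos hκ
  have hy : 0 < 36 * κ ^ (2 + a) := by positivity
  have hlogy : Real.log (36 * κ ^ (2 + a)) = Real.log 36 + (2 + a) * Real.log κ := by
    rw [Real.log_mul (by norm_num) (by positivity), Real.log_rpow hκ0]
  have h36 : Real.log 36 ≤ 6 * Real.log 2 := by
    rw [← Real.log_rpow two_pos]
    exact Real.log_le_log (by norm_num) (by norm_num)
  have h36' : 0 ≤ Real.log 36 := Real.log_nonneg (by norm_num)
  -- With 36 ≤ 2^6, rounding up, and the summand 2, the constant is 6 + 1 + 2 = 9 bits; as κ ≥ 2,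
  -- these are at most 9 log₂ κ, and 9 + (2 + a) = 11 + a.
  refine ⟨⌈Real.log (36 * κ ^ (2 + a)) / Real.log 2⌉₊, ?_, ?_⟩
  · have h1 := Nat.le_ceil (Real.log (36 * κ ^ (2 + a)) / Real.log 2)
    rw [div_le_iff₀ hlog2, ← Real.log_pow] at h1
    exact (Real.log_le_log_iff hy (by positivity)).1 h1
  · have h0 : 0 ≤ Real.log (36 * κ ^ (2 + a)) / Real.log 2 := by
      rw [hlogy]
      have : 0 ≤ (2 + a) * Real.log κ := mul_nonneg (by linarith) (by linarith)
      positivity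
    have h1 := (Nat.ceil_lt_add_one h0).le
    have h2 : Real.log (36 * κ ^ (2 + a)) / Real.log 2 * Real.log 2
        = Real.log (36 * κ ^ (2 + a)) := div_mul_cancel₀ _ hlog2.ne'
    have h3 := mul_le_mul_of_nonneg_right h1 hlog2.le
    rw [add_mul, h2, hlogy] at h3
    nlinarith

/-- The gain of the colors: `hpl` and `hl` give 1/p = O(log κ / log n), by which the quadratic term
shrinks. -/
theorem colored_rounds_le {K k q p d t l n : ℕ} {a κ : ℝ} (hk : 1 ≤ k) (hK : K ≤ k)
    (hdk : d ≤ k) (hq : q ≤ 2 * d) (hqn : q ≤ n) (hp : 0 < p) (hd : (d : ℝ) ≤ 3 * κ)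
    (hκ : 2 ≤ κ) (ha : 0 < a) (hn : 1 ≤ n)
    (hl : ((l : ℝ) + 2) * Real.log 2 ≤ (11 + a) * Real.log κ)
    (hpl : Nat.log 2 n < 2 * p * (l + 2)) (ht : t ≤ 12 * K + 3 + q * (2 * q / p + 1)) :
    (t : ℝ) ≤ (18 + 288 * (11 + a)) * (k + κ ^ 2 * Real.log κ / Real.log n) := by
  have hk' : (1 : ℝ) ≤ k := by exact_mod_cast hk
  have hlogκ : 0 < Real.log κ := Real.log_pos (by linarith)
  rcases hn.eq_or_lt with rfl | hn
  -- For n = 1 the fraction is 0 and cannot pay for the packets, but then q ≤ n = 1.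
  · have h2 : q * (2 * q / p + 1) ≤ 3 := by
      have h1 : 2 * q / p ≤ 2 * q := Nat.div_le_self _ _
      have h3 : 2 * q / p + 1 ≤ 3 := by omega
      calc q * (2 * q / p + 1) ≤ 1 * 3 := Nat.mul_le_mul hqn h3
        _ = 3 := rfl
    have h3 : (t : ℝ) ≤ 18 * k := by
      have : t ≤ 18 * k := by omega
      exact_mod_cast this
    simp only [Nat.cast_one, Real.log_one, div_zero, add_zero]
    nlinarith
  · have hn' : (1 : ℝ) < n := by exact_mod_cast hn
    have hlogn : 0 < Real.log n := Real.log_pos hn'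
    have hlog2 : 0 < Real.log 2 := Real.log_pos one_lt_two
    have hp' : (0 : ℝ) < p := by exact_mod_cast hp
    have hq' : (q : ℝ) ≤ 6 * κ := by
      have : (q : ℝ) ≤ 2 * d := by exact_mod_cast hq
      linarith
    have h1 : (t : ℝ) ≤ 17 * k + 2 * (q : ℝ) ^ 2 / p := by
      have h2 : t ≤ 17 * k + q * (2 * q / p) := by
        have : q * (2 * q / p + 1) = q * (2 * q / p) + q := by ring
        omega
      have h3 : ((2 * q / p : ℕ) : ℝ) ≤ 2 * q / p := by
        have := Nat.cast_div_le (α := ℝ) (m := 2 * q) (n := p)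
        simpa using this
      have h4 : (t : ℝ) ≤ 17 * k + q * ((2 * q / p : ℕ) : ℝ) := by exact_mod_cast h2
      have h5 := mul_le_mul_of_nonneg_left h3 (Nat.cast_nonneg (α := ℝ) q)
      have h6 : (q : ℝ) * (2 * q / p) = 2 * (q : ℝ) ^ 2 / p := by ring
      linarith
    have h2 : Real.log n ≤ 2 * (2 * p * (l + 2)) * Real.log 2 := by
      have h3 : n < 2 ^ (Nat.log 2 n + 1) := Nat.lt_pow_succ_log_self one_lt_two n
      have h4 : n ≤ 2 ^ (2 * (2 * p * (l + 2))) :=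
        h3.le.trans (Nat.pow_le_pow_right two_pos (by omega))
      have h5 : (n : ℝ) ≤ 2 ^ (2 * (2 * p * (l + 2))) := by exact_mod_cast h4
      have h6 := Real.log_le_log (by linarith) h5
      rw [Real.log_pow] at h6
      exact_mod_cast h6
    have h3 : Real.log n ≤ 4 * (11 + a) * Real.log κ * p := by nlinarith
    have h4 : 1 / (p : ℝ) ≤ 4 * (11 + a) * Real.log κ / Real.log n := by
      rw [div_le_div_iff₀ hp' hlogn]
      linarith
    have h5 : 2 * (q : ℝ) ^ 2 / p ≤ 288 * (11 + a) * (κ ^ 2 * Real.log κ / Real.log n) := by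
      have h6 : (q : ℝ) ^ 2 ≤ (6 * κ) ^ 2 := pow_le_pow_left₀ (Nat.cast_nonneg q) hq' 2
      calc 2 * (q : ℝ) ^ 2 / p = 2 * (q : ℝ) ^ 2 * (1 / p) := by ring
        _ ≤ 2 * (6 * κ) ^ 2 * (4 * (11 + a) * Real.log κ / Real.log n) :=
            mul_le_mul (by linarith) h4 (by positivity) (by positivity)
        _ = 288 * (11 + a) * (κ ^ 2 * Real.log κ / Real.log n) := by ring
    have h6 : 0 ≤ κ ^ 2 * Real.log κ / Real.log n := by positivity
    nlinarith

theorem exists_detApprox {c : ℕ} (hc : 1 ≤ c) {k : ℕ} {ε : ℝ} (hk : 1 ≤ k)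
    (hε : ε ∈ Set.Icc (1 / (k : ℝ)) 1) : ∃ A : Algorithm Unit,
      IsDetApprox c (8 * c + 18) k (2 - ε) (fun _ => 108 * ((k : ℝ) + ((k : ℝ) * ε) ^ 2)) A := by
  obtain ⟨K, m, hKm, hm, hK, hd⟩ := exists_split hk hε
  refine ⟨(⟨c, K, m, 0, False⟩ : Params).algorithm fun _ => 0, fun V _ N hconn hid => ?_⟩
  obtain ⟨h1, t, ht, h2⟩ := plain_algorithm_spec (I := Unit) hc hk hKm hm hK hd hconn hid
  exact ⟨h1 _, t, ht, (h2 _).2⟩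

theorem exists_randApprox {c : ℕ} (hc : 1 ≤ c) {a : ℝ} (ha : 0 < a) {k : ℕ} {ε δ : ℝ} (hk : 1 ≤ k)
    (hε : ε ∈ Set.Icc (1 / (k : ℝ)) 1) (hδ : ((k : ℝ) * ε) ^ (-a) ≤ δ) :
    ∃ (l : ℕ) (A : Algorithm (Fin l → Bool)), IsRandApprox c (8 * c + 18) k (2 - ε) δ
      (fun n => (540 + 288 * (11 + a)) * ((k : ℝ) +
        ((k : ℝ) * ε) ^ 2 * Real.log ((k : ℝ) * ε) / Real.log (n : ℝ))) A := by
  obtain ⟨K, m, hKm, hm, hK, hd⟩ := exists_split hk hε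
  have hk' : (1 : ℝ) ≤ k := by exact_mod_cast hk
  have hκ1 : 1 ≤ (k : ℝ) * ε := by
    have := hε.1
    rwa [div_le_iff₀' (by linarith)] at this
  have hfrac : ∀ n : ℕ, 0 ≤ ((k : ℝ) * ε) ^ 2 * Real.log ((k : ℝ) * ε) / Real.log (n : ℝ) :=
    fun n => div_nonneg (mul_nonneg (sq_nonneg _) (Real.log_nonneg hκ1)) (Real.log_natCast_nonneg n)
  have hδ0 : 0 ≤ δ := le_trans (by positivity) hδ
  -- For small kε its logarithm may vanish, so the deterministic algorithm is used: 108(k + 4) ≤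
  -- 540k rounds, without errors.
  by_cases hκ : (k : ℝ) * ε < 2
  · refine ⟨0, (⟨c, K, m, 0, False⟩ : Params).algorithm fun _ => 0, fun V _ N hconn hid => ?_⟩
    obtain ⟨h1, t, ht, h2⟩ := plain_algorithm_spec (I := Fin 0 → Bool) hc hk hKm hm hK hd hconn hid
    refine ⟨h1, t, ht.trans ?_, fun x => (h2 x).1, ?_⟩
    · have := hfrac (Fintype.card V)
      nlinarith
    · have : {x : V → Fin 0 → Bool | ¬ ((⟨c, K, m, 0, False⟩ : Params).algorithm
          fun _ => 0).Succeeds N k (2 - ε) x t} = ∅ :=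
        Set.eq_empty_of_forall_notMem fun x hx => hx (h2 x).2
      rw [this, uniformProb]
      simpa using hδ0
  · push Not at hκ
    obtain ⟨l, hl1, hl2⟩ := exists_color_length ha hκ
    have hcardI : Fintype.card (Fin l → Bool) = 2 ^ l := by simp
    set color : (Fin l → Bool) → ℕ := fun i => (Fintype.equivFinOfCardEq hcardI i : ℕ) with hcolor
    have hcolor_inj : Function.Injective color := fun i j h =>
      (Fintype.equivFinOfCardEq hcardI).injective (Fin.ext h)
    have hκpow : (k : ℝ) * ε ≤ ((k : ℝ) * ε) ^ (2 + a) := by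
      have := Real.rpow_le_rpow_of_exponent_le hκ1 (show (1 : ℝ) ≤ 2 + a by linarith)
      rwa [Real.rpow_one] at this
    have hl3 : 2 * (K - m) ≤ 2 ^ l := by
      have : ((2 * (K - m) : ℕ) : ℝ) ≤ ((2 ^ l : ℕ) : ℝ) := by
        push_cast [Nat.cast_sub hm] at hd ⊢
        linarith
      exact_mod_cast this
    refine ⟨l, (⟨c, K, m, l, True⟩ : Params).algorithm color, fun V _ N hconn hid => ?_⟩
    obtain ⟨h1, q, p, W, hq, hqn, hp, hpl, hW, t, ht, h2⟩ := algorithm_spec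
      (P := ⟨c, K, m, l, True⟩) (color := color) (α := 2 - ε) hc hm
      (fun i => (Fintype.equivFinOfCardEq hcardI i).2) hid hconn (fun _ => hl3)
      (by rw [hKm]; exact hK)
    have hpos : 1 ≤ Fintype.card V := by
      have := hconn.nonempty
      exact Fintype.card_pos
    refine ⟨h1, t, ?_, fun x => (h2 x).1, ?_⟩
    · refine (colored_rounds_le hk (show K ≤ k by omega) (show K - m ≤ k by omega) hq hqn hp hd hκ
        ha hpos hl2 (hpl trivial) ht).trans ?_
      have := hfrac (Fintype.card V)
      nlinarith
    · have hfail : ∀ x ∈ {x : V → Fin l → Bool | ¬ ((⟨c, K, m, l, True⟩ : Params).algorithm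
          color).Succeeds N k (2 - ε) x t}, ¬ Set.InjOn x W := by
        intro x hx hinj
        refine hx ?_
        rw [← hKm]
        exact (h2 x).2 fun _ v hv w hw h => hinj hv hw (hcolor_inj h)
      -- With |W| ≤ 6κ the collision bound is 36κ²/2^l, which explains the condition 36κ^(2+a) ≤
      -- 2^l.
      refine (uniformProb_not_injOn_le W hfail).trans (le_trans ?_ hδ)
      · have hW' : (W.card : ℝ) ≤ 6 * (k * ε) := by
          have h3 : (W.card : ℝ) ≤ ((2 * (K - m) : ℕ) : ℝ) := by exact_mod_cast hW
          rw [Nat.cast_mul] at h3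
          push_cast at h3 ⊢
          linarith
        have hκ0 : 0 < (k : ℝ) * ε := by linarith
        rw [Nat.card_eq_fintype_card, hcardI]
        push_cast
        generalize (k : ℝ) * ε = κ at hl1 hW' hκ0
        calc (W.card : ℝ) ^ 2 / 2 ^ l ≤ (6 * κ) ^ 2 / (36 * κ ^ (2 + a)) :=
              div_le_div₀ (by positivity) (pow_le_pow_left₀ (Nat.cast_nonneg _) hW' 2)
                (by positivity) hl1
          _ = κ ^ (-a) := by
              rw [Real.rpow_add hκ0, Real.rpow_neg hκ0.le, Real.rpow_two]
              have := Real.rpow_pos_of_pos hκ0 a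
              field_simp
              norm_num

end Congest

theorem mainTheorem8 (c : ℕ) (hc : 1 ≤ c) :
    ∃ B : ℕ,
      (∃ C : ℝ, ∀ (k : ℕ) (ε : ℝ), 1 ≤ k → ε ∈ Set.Icc (1 / (k : ℝ)) 1 →
        ∃ A : Congest.Algorithm Unit,
          Congest.IsDetApprox c B k (2 - ε) (fun _ => C * ((k : ℝ) + ((k : ℝ) * ε) ^ 2)) A) ∧
      (∀ a : ℝ, 0 < a →
        ∃ C : ℝ, ∀ (k : ℕ) (ε δ : ℝ), 1 ≤ k → ε ∈ Set.Icc (1 / (k : ℝ)) 1 →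
          ((k : ℝ) * ε) ^ (-a) ≤ δ →
          ∃ (l : ℕ) (A : Congest.Algorithm (Fin l → Bool)),
            Congest.IsRandApprox c B k (2 - ε) δ
              (fun n => C * ((k : ℝ) +
                ((k : ℝ) * ε) ^ 2 * Real.log ((k : ℝ) * ε) / Real.log (n : ℝ))) A) :=
  ⟨8 * c + 18, ⟨108, fun _ _ hk hε => Congest.exists_detApprox hc hk hε⟩,
    fun a ha => ⟨540 + 288 * (11 + a), fun _ _ _ hk hε hδ =>
      Congest.exists_randApprox hc ha hk hε hδ⟩⟩
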